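/- Let $(\mathcal C,\otimes,I,\alpha,\lambda,\rho,\sigma)$ be a symmetric monoidal category. A \emph{partial trace} on $\mathcal C$ (Haghverdi–Scott) is a family of partial functions $\mathrm{Tr}^U_{X,Y}:\mathcal C(X\otimes U,Y\otimes U)\rightharpoonup\mathcal C(X,Y)$ satisfying the following axioms. Here $a\simeq b$ means that $a$ and $b$ are both undefined or both defined and equal, $a\preceq b$ means that if $a$ is defined then $b$ is defined and equal to it, and associativity isomorphisms are suppressed. - Naturality: $h\circ\mathrm{Tr}^U_{X,Y}(f)\circ g\preceq\mathrm{Tr}^U_{X',Y'}((h\otimes 1_U)\circ f\circ(g\otimes 1_U))$ for $f:X\otimes U\to Y\otimes U$, $g:X'\to X$, $h:Y\to Y'$. - Dinaturality: $\mathrm{Tr}^U_{X,Y}((1_Y\otimes g)\circ f)\simeq\mathrm{Tr}^{U'}_{X,Y}(f\circ(1_X\otimes g))$ for $f:X\otimes U\to Y\otimes U'$, $g:U'\to U$. - Vanishing I: $\mathrm{Tr}^I_{X,Y}(f)\simeq\rho_Y\circ f\circ\rho_X^{-1}$ for $f:X\otimes I\to Y\otimes I$, where $\rho_X:X\otimes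 I\to X$. - Vanishing II: if $\mathrm{Tr}^V_{X\otimes U,Y\otimes U}(g)$ is defined, then $\mathrm{Tr}^{U\otimes V}_{X,Y}(g)\simeq\mathrm{Tr}^U_{X,Y}(\mathrm{Tr}^V_{X\otimes U,Y\otimes U}(g))$, for $g:X\otimes U\otimes V\to Y\otimes U\otimes V$. - Superposing: $g\otimes\mathrm{Tr}^U_{X,Y}(f)\preceq\mathrm{Tr}^U_{W\otimes X,Z\otimes Y}(g\otimes f)$ for $f:X\otimes U\to Y\otimes U$, $g:W\to Z$. - Yanking: $\mathrm{Tr}^U_{U,U}(\sigma_{U,U})\simeq 1_U$. A \emph{partially traced category} is a symmetric monoidal category with a partial trace; it is \emph{totally traced} if $\mathrm{Tr}$ is everywhere defined. A compact closed category (a symmetric monoidal category in which every object $U$ has a dual $U^*$ with $\eta_U:I\to U\otimes U^*$, $\varepsilon_U:U^*\otimes U\to I$ satisfying the triangle identities) carries the canonical operation $\mathrm{Tr}^U_{A,B}(f)=(1_B\otimes\varepsilon_U\sigma_{U,U^*})\circ(f\otimes 1_{U^*})\circ(1_A\otimes\eta_U)$. If $F:\mathcal C\to\mathcal D$ is a strong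 symmetric monoidal functor with structure maps $m_{X,U}:FX\otimes FU\to F(X\otimes U)$, and $\mathrm{Tr}$ and $\widehat{\mathrm{Tr}}$ are families of partial functions as above on $\mathcal D$ and $\mathcal C$ respectively, say that $\widehat{\mathrm{Tr}}$ is \emph{induced} by $\mathrm{Tr}$ along $F$ if for all $f:X\otimes U\to Y\otimes U$ and $g:X\to Y$ in $\mathcal C$: $\widehat{\mathrm{Tr}}^U_{X,Y}(f)$ is defined and equal to $g$ if and only if $\mathrm{Tr}^{FU}_{FX,FY}(m_{Y,U}^{-1}\circ F(f)\circ m_{X,U})$ is defined and equal to $F(g)$. \textbf{Theorem.} (1) Let $(\mathcal C,\widehat{\mathrm{Tr}})$ be a partially traced category. Then there are a compact closed category $\mathcal D$, whose canonical operation is a total trace, and a faithful strong symmetric monoidal functor $F:\mathcal C\to\mathcal D$, injective on objects, such that $\widehat{\mathrm{Tr}}$ is induced along $F$ by the canonical trace of $\mathcal D$; in particular $F$ preserves the trace: if $\widehat{\mathrm{Tr}}^U_{X,Y}(f)$ is defined, then $F(\widehat{\mathrm{Tr}}^U_{X,Y}(f))=\mathrm{Tr}^{FU}_{FX,FY}(m_{Y,U}^{-1}\circ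 F(f)\circ m_{X,U})$. If moreover $\mathcal C$ is strict monoidal, then $\mathcal D$ and $F$ can be taken strict monoidal as well. (2) Conversely, if $\mathcal D$ is a partially (for instance, totally) traced category, $\mathcal C$ is a symmetric monoidal category and $F:\mathcal C\to\mathcal D$ is a faithful strong symmetric monoidal functor, then there is exactly one partial trace on $\mathcal C$ that is induced along $F$ by the trace of $\mathcal D$. Thus partially traced categories are exactly the monoidal subcategories of totally traced categories, with the induced trace. -/

import Mathlib

open CategoryTheory MonoidalCategory

universe u v u₁ v₁ u₂ v₂

/-- A family of partial functions `Tr^U_{X,Y} : C(X ⊗ U, Y ⊗ U) ⇀ C(X, Y)`.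
`T U f : Part (X ⟶ Y)` is the possibly undefined value at `f`; equality in `Part` is
Kleene equality, and `g ∈ T U f` says that `T U f` is defined with value `g`. -/
abbrev PartialTraceOp (C : Type u) [Category.{v} C] [MonoidalCategory C] : Type (max u v) :=
  ∀ ⦃X Y : C⦄ (U : C), (X ⊗ U ⟶ Y ⊗ U) → Part (X ⟶ Y)

/-- The axioms of a partial trace on a symmetric monoidal category (Haghverdi and Scott). -/
structure IsPartialTrace {C : Type u} [Category.{v} C] [MonoidalCategory C]
    [SymmetricCategory C] (T : PartialTraceOp C) : Prop where
  /-- Directed Kleene equality: whenever the left-hand side is defined. -/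
  naturality : ∀ {X X' Y Y' U : C} (f : X ⊗ U ⟶ Y ⊗ U) (g : X' ⟶ X) (h : Y ⟶ Y') (k : X ⟶ Y),
    k ∈ T U f → g ≫ k ≫ h ∈ T U ((g ▷ U) ≫ f ≫ (h ▷ U))
  dinaturality : ∀ {X Y U U' : C} (f : X ⊗ U ⟶ Y ⊗ U') (g : U' ⟶ U),
    T U (f ≫ (Y ◁ g)) = T U' ((X ◁ g) ≫ f)
  vanishing_unit : ∀ {X Y : C} (f : X ⊗ 𝟙_ C ⟶ Y ⊗ 𝟙_ C),
    T (𝟙_ C) f = Part.some ((ρ_ X).inv ≫ f ≫ (ρ_ Y).hom)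
  /-- If the inner trace is defined, with value `k`, then the two sides are Kleene equal. -/
  vanishing_tensor : ∀ {X Y U V : C} (g : X ⊗ (U ⊗ V) ⟶ Y ⊗ (U ⊗ V)) (k : X ⊗ U ⟶ Y ⊗ U),
    k ∈ T V ((α_ X U V).hom ≫ g ≫ (α_ Y U V).inv) → T (U ⊗ V) g = T U k
  /-- Directed Kleene equality: whenever the trace of `f` is defined. -/
  superposing : ∀ {X Y U W Z : C} (f : X ⊗ U ⟶ Y ⊗ U) (g : W ⟶ Z) (k : X ⟶ Y),
    k ∈ T U f → (g ⊗ₘ k) ∈ T U ((α_ W X U).hom ≫ (g ⊗ₘ f) ≫ (α_ Z Y U).inv)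
  yanking : ∀ U : C, T U (β_ U U).hom = Part.some (𝟙 U)

/-- A (total) trace: a partial trace that is everywhere defined. -/
structure IsTotalTrace {C : Type u} [Category.{v} C] [MonoidalCategory C]
    [SymmetricCategory C] (T : PartialTraceOp C) : Prop extends IsPartialTrace T where
  total : ∀ {X Y U : C} (f : X ⊗ U ⟶ Y ⊗ U), (T U f).Dom

/-- The canonical trace `(1 ⊗ εσ) (f ⊗ 1) (1 ⊗ η)` of a compact closed category, that is, of a
symmetric monoidal category in which every object `U` has a dual `Uᘁ` with unit
`η : 𝟙 ⟶ U ⊗ Uᘁ` and counit `ε : Uᘁ ⊗ U ⟶ 𝟙` (`RightRigidCategory`). -/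
def canonicalTrace (D : Type u) [Category.{v} D] [MonoidalCategory D] [SymmetricCategory D]
    [RightRigidCategory D] : PartialTraceOp D := fun X Y U f =>
  Part.some ((ρ_ X).inv ≫ (X ◁ (η_ U (Uᘁ))) ≫ (α_ X U (Uᘁ)).inv ≫ (f ▷ (Uᘁ)) ≫
    (α_ Y U (Uᘁ)).hom ≫ (Y ◁ ((β_ U (Uᘁ)).hom ≫ ε_ U (Uᘁ))) ≫ (ρ_ Y).hom)

/-- Along the strong monoidal functor `F`, the operation `T` on `C` is the one induced by the
operation `t` on `D`: the value `T U f` is defined and equal to `g` exactly when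
`Tr^{FU}(m⁻¹ ∘ F f ∘ m)` is defined and equal to `F g`. In particular `F` preserves the trace. -/
def IsInducedTrace {C : Type u₁} [Category.{v₁} C] [MonoidalCategory C]
    {D : Type u₂} [Category.{v₂} D] [MonoidalCategory D] (F : C ⥤ D) [F.Monoidal]
    (t : PartialTraceOp D) (T : PartialTraceOp C) : Prop :=
  ∀ {X Y U : C} (f : X ⊗ U ⟶ Y ⊗ U) (g : X ⟶ Y),
    g ∈ T U f ↔
      F.map g ∈ t (F.obj U)
        (Functor.LaxMonoidal.μ F X U ≫ F.map f ≫ Functor.OplaxMonoidal.δ F Y U)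

/-- A monoidal category is strict: the tensor product is strictly associative and unital on
objects and the structural isomorphisms are identities. -/
structure IsStrictMonoidal (C : Type u) [Category.{v} C] [MonoidalCategory C] : Prop where
  tensor_assoc : ∀ X Y Z : C, (X ⊗ Y) ⊗ Z = X ⊗ (Y ⊗ Z)
  unit_tensor : ∀ X : C, 𝟙_ C ⊗ X = X
  tensor_unit : ∀ X : C, X ⊗ 𝟙_ C = X
  associator_eq : ∀ X Y Z : C, (α_ X Y Z).hom = eqToHom (tensor_assoc X Y Z)
  leftUnitor_eq : ∀ X : C, (λ_ X).hom = eqToHom (unit_tensor X)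
  rightUnitor_eq : ∀ X : C, (ρ_ X).hom = eqToHom (tensor_unit X)

/-- A monoidal functor is strict: it preserves tensor and unit on the nose and its structure
maps are identities. -/
structure IsStrictMonoidalFunctor {C : Type u₁} [Category.{v₁} C] [MonoidalCategory C]
    {D : Type u₂} [Category.{v₂} D] [MonoidalCategory D] (F : C ⥤ D) [F.Monoidal] : Prop where
  obj_tensor : ∀ X Y : C, F.obj X ⊗ F.obj Y = F.obj (X ⊗ Y)
  obj_unit : 𝟙_ D = F.obj (𝟙_ C)
  μ_eq : ∀ X Y : C, Functor.LaxMonoidal.μ F X Y = eqToHom (obj_tensor X Y)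
  ε_eq : Functor.LaxMonoidal.ε F = eqToHom obj_unit

/-!
# Partially traced categories embed in compact closed categories

*The converse direction.* Along a faithful strong symmetric monoidal functor `F` the induced
operation is forced (`IsInducedTrace.unique`), and each axiom is reflected along `F`
(`IsInducedTrace.isPartialTrace`).

*The embedding.* Let `T` be a partial trace on `C`. A compact closed category over `C` has to
contain formal duals, so its objects are those of `E = C × Cᵒᵖ`, the pair `(P, N)` standing for
`P ⊗ N*`; it also has to contain a cup `𝟙 ⟶ Z ⊗ Z*` and a cap `Z ⊗ Z* ⟶ 𝟙` for every `Z`. Instead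
of presenting such a category by generators and relations, which would make faithfulness hard to
prove, its morphisms are taken to be operations on observations.

An observation of type `(P, N)` with result in `Y` is a `Test`: a partial function which, for all
`X` and `W`, sends morphisms `X ⊗ (N ⊗ W) ⟶ P ⊗ W` of `C` to morphisms `X ⟶ Y`. The object `W` is
hidden: a test is required to be dinatural in `W`, and not to notice when a part of `W` is traced
out by `T` beforehand. Morphisms of `E` act on tests by restriction. A cap adds `Z` to the hidden
object (`Test.cap`), and a cup puts an identity strand on `Z` in parallel with the argument
(`Test.cup`). The axioms of a partial trace say exactly that `c ↦ T W c` is a test (`Test.unit`; the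
axiom `vanishing_tensor` is the insensitivity to partial tracing), and naturality and superposing
make the class of tests stable under restriction, caps and cups. Since the operations on tests act
next to an arbitrary spectator object, and cups and caps satisfy the exchange law with one another
(`Test.cup_cup`, `Test.cap_cup`, `Test.cap_cap`), the operations generated by them and by the
morphisms of `E` form a symmetric monoidal category (`Extension`).

Its key property is that a cup followed by `f : X ⊗ U ⟶ Y ⊗ U` and a cap acts on tests like `g`
whenever `g ∈ T U f` (`Test.cup_map_cap_of_mem`), because tests do not notice partial tracing. With
`f` the symmetry of `U` and `g = 𝟙` this gives one triangle identity, and `Test.cup_cap_neg` gives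
the other, so that `(Z, 𝟙)` and `(𝟙, Z)` are dual and every object has a dual. Conversely,
evaluating at the unit test shows that the canonical trace of the image of `f` can be the image of
`g` only if `g ∈ T U f` (`mem_of_loop_eq`), and that the embedding is faithful
(`lift_posHom_injective`). Since the structural isomorphisms of the new category come from those of
`E`, strictness is inherited.
-/

namespace PartialTrace

universe w w'

/-! ### The canonical trace of a compact closed category -/

section PairTrace

variable {D : Type u} [Category.{v} D] [MonoidalCategory D]

/-- The operation `f ↦ (1 ⊗ e) (f ⊗ 1) (1 ⊗ η)` attached to arbitrary morphisms
`η : 𝟙 ⟶ U ⊗ V` and `e : U ⊗ V ⟶ 𝟙`. -/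
def pairTrace {X Y U V : D} (η : 𝟙_ D ⟶ U ⊗ V) (e : U ⊗ V ⟶ 𝟙_ D) (f : X ⊗ U ⟶ Y ⊗ U) :
    X ⟶ Y :=
  (ρ_ X).inv ≫ X ◁ η ≫ (α_ X U V).inv ≫ f ▷ V ≫ (α_ Y U V).hom ≫ Y ◁ e ≫ (ρ_ Y).hom

theorem pairTrace_naturality {X X' Y Y' U V : D} (η : 𝟙_ D ⟶ U ⊗ V) (e : U ⊗ V ⟶ 𝟙_ D)
    (f : X ⊗ U ⟶ Y ⊗ U) (g : X' ⟶ X) (h : Y ⟶ Y') :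
    pairTrace η e ((g ▷ U) ≫ f ≫ (h ▷ U)) = g ≫ pairTrace η e f ≫ h := by
  unfold pairTrace
  calc
    _ = 𝟙 _ ⊗≫ (X' ◁ η ≫ g ▷ (U ⊗ V)) ⊗≫ f ▷ V ⊗≫ (h ▷ (U ⊗ V) ≫ Y' ◁ e) ⊗≫ 𝟙 _ := by monoidal
    _ = 𝟙 _ ⊗≫ (g ▷ 𝟙_ D ≫ X ◁ η) ⊗≫ f ▷ V ⊗≫ (Y ◁ e ≫ h ▷ 𝟙_ D) ⊗≫ 𝟙 _ := by
      rw [whisker_exchange, whisker_exchange]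
    _ = _ := by monoidal

theorem pairTrace_superposing {X Y W Z U V : D} (η : 𝟙_ D ⟶ U ⊗ V) (e : U ⊗ V ⟶ 𝟙_ D)
    (f : X ⊗ U ⟶ Y ⊗ U) (g : W ⟶ Z) :
    pairTrace η e ((α_ W X U).hom ≫ (g ⊗ₘ f) ≫ (α_ Z Y U).inv) = g ⊗ₘ pairTrace η e f := by
  unfold pairTrace
  rw [MonoidalCategory.tensorHom_def, MonoidalCategory.tensorHom_def]
  calc
    _ = 𝟙 _ ⊗≫ (W ◁ X ◁ η ≫ g ▷ (X ⊗ U ⊗ V)) ⊗≫ Z ◁ f ▷ V ⊗≫ Z ◁ Y ◁ e ⊗≫ 𝟙 _ := by monoidal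
    _ = 𝟙 _ ⊗≫ (g ▷ (X ⊗ 𝟙_ D) ≫ Z ◁ X ◁ η) ⊗≫ Z ◁ f ▷ V ⊗≫ Z ◁ Y ◁ e ⊗≫ 𝟙 _ := by
      rw [whisker_exchange]
    _ = _ := by monoidal

/-- Dinaturality in a morphism `g : U' ⟶ U` which has a mate `m : V ⟶ V'`. -/
theorem pairTrace_dinaturality {X Y U U' V V' : D} {η : 𝟙_ D ⟶ U ⊗ V} {e : U ⊗ V ⟶ 𝟙_ D}
    {η' : 𝟙_ D ⟶ U' ⊗ V'} {e' : U' ⊗ V' ⟶ 𝟙_ D} (g : U' ⟶ U) (m : V ⟶ V')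
    (hη : η ≫ U ◁ m = η' ≫ g ▷ V') (he : g ▷ V ≫ e = U' ◁ m ≫ e') (f : X ⊗ U ⟶ Y ⊗ U') :
    pairTrace η e (f ≫ (Y ◁ g)) = pairTrace η' e' ((X ◁ g) ≫ f) := by
  unfold pairTrace
  calc
    _ = 𝟙 _ ⊗≫ X ◁ η ⊗≫ f ▷ V ⊗≫ Y ◁ (g ▷ V ≫ e) ⊗≫ 𝟙 _ := by monoidal
    _ = 𝟙 _ ⊗≫ X ◁ η ⊗≫ (f ▷ V ≫ (Y ⊗ U') ◁ m) ⊗≫ Y ◁ e' ⊗≫ 𝟙 _ := by rw [he]; monoidal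
    _ = 𝟙 _ ⊗≫ X ◁ (η ≫ U ◁ m) ⊗≫ f ▷ V' ⊗≫ Y ◁ e' ⊗≫ 𝟙 _ := by
      rw [← whisker_exchange]; monoidal
    _ = _ := by rw [hη]; monoidal

/-- Two successive traces amount to a single one along the nested pair. -/
theorem pairTrace_pairTrace {X Y U U' V V' : D} (η : 𝟙_ D ⟶ U ⊗ V) (e : U ⊗ V ⟶ 𝟙_ D)
    (η' : 𝟙_ D ⟶ U' ⊗ V') (e' : U' ⊗ V' ⟶ 𝟙_ D) (g : X ⊗ (U ⊗ U') ⟶ Y ⊗ (U ⊗ U')) :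
    pairTrace η e (pairTrace η' e' ((α_ X U U').hom ≫ g ≫ (α_ Y U U').inv)) =
      pairTrace (V := V' ⊗ V) (η ⊗≫ (U ◁ η') ▷ V ⊗≫ 𝟙 _) (𝟙 _ ⊗≫ (U ◁ e') ▷ V ⊗≫ e) g := by
  unfold pairTrace
  monoidal

end PairTrace

section Compact

variable {D : Type u} [Category.{v} D] [MonoidalCategory D] [SymmetricCategory D]

/-- The trace over `U` computed with a chosen dual pair `(U, V)`. -/
abbrev dualTrace {X Y : D} (U V : D) [ExactPairing U V] (f : X ⊗ U ⟶ Y ⊗ U) : X ⟶ Y :=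
  pairTrace (η_ U V) ((β_ U V).hom ≫ ε_ U V) f

theorem dualTrace_dinaturality {X Y U U' V V' : D} [i : ExactPairing U V] [i' : ExactPairing U' V']
    (f : X ⊗ U ⟶ Y ⊗ U') (g : U' ⟶ U) :
    dualTrace U V (f ≫ (Y ◁ g)) = dualTrace U' V' ((X ◁ g) ≫ f) := by
  let : HasRightDual U := ⟨V⟩
  let : HasRightDual U' := ⟨V'⟩
  refine pairTrace_dinaturality g (rightAdjointMate g) (coevaluation_comp_rightAdjointMate g) ?_ f
  have h := rightAdjointMate_comp_evaluation g
  change g ▷ V ≫ _ = U' ◁ (rightAdjointMate g : V ⟶ V') ≫ _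
  rw [BraidedCategory.braiding_naturality_left_assoc]
  exact (congrArg ((β_ U' V).hom ≫ ·) h.symm).trans
    (BraidedCategory.braiding_naturality_right_assoc U' (rightAdjointMate g : V ⟶ V') _).symm

/-- The trace does not depend on the choice of the dual: dinaturality in the identity. -/
theorem dualTrace_eq {X Y U : D} (V V' : D) [ExactPairing U V] [ExactPairing U V']
    (f : X ⊗ U ⟶ Y ⊗ U) : dualTrace U V f = dualTrace U V' f := by
  simpa using dualTrace_dinaturality (V := V) (V' := V') f (𝟙 U)

/-- A strand `W` slides through a cap `e`. -/
theorem braiding_cap {U V : D} (e : U ⊗ V ⟶ 𝟙_ D) (W : D) :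
    (β_ U W).hom ▷ V ⊗≫ W ◁ e ⊗≫ 𝟙 W = 𝟙 _ ⊗≫ U ◁ (β_ W V).hom ⊗≫ e ▷ W ⊗≫ 𝟙 W := by
  have h := BraidedCategory.braiding_naturality_right W e
  rw [BraidedCategory.braiding_tensor_right_hom, braiding_tensorUnit_right] at h
  calc
    _ = (β_ U W).hom ▷ V ⊗≫ (W ◁ e ≫ (ρ_ W).hom ≫ (λ_ W).inv) ⊗≫ 𝟙 W := by monoidal
    _ = ((β_ U W).hom ≫ (β_ W U).hom) ▷ V ⊗≫ U ◁ (β_ W V).hom ⊗≫ e ▷ W ⊗≫ 𝟙 W := by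
      rw [h]; monoidal
    _ = _ := by rw [SymmetricCategory.symmetry]; monoidal

/-- The cap of a tensor product of dual pairs is the nested cap. -/
theorem braiding_evaluation_tensor {U U' V V' : D} [ExactPairing U V] [ExactPairing U' V'] :
    (β_ (U ⊗ U') (V' ⊗ V)).hom ≫ ε_ (U ⊗ U') (V' ⊗ V) =
      𝟙 _ ⊗≫ (U ◁ ((β_ U' V').hom ≫ ε_ U' V')) ▷ V ⊗≫ (β_ U V).hom ≫ ε_ U V := by
  rw [ExactPairing.tensor_evaluation]
  have h1 := braiding_cap ((β_ U V).hom ≫ ε_ U V) V'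
  have h2 := BraidedCategory.braiding_naturality_left (ε_ U' V') V
  rw [braiding_tensorUnit_left, BraidedCategory.braiding_tensor_left_hom] at h2
  calc
    _ = 𝟙 _ ⊗≫ U ◁ ((β_ U' V').hom ▷ V ⊗≫ V' ◁ (β_ U' V).hom) ⊗≫
          ((β_ U V').hom ▷ V ⊗≫ V' ◁ ((β_ U V).hom ≫ ε_ U V) ⊗≫ 𝟙 V') ▷ U' ⊗≫ ε_ U' V' := by
      rw [BraidedCategory.braiding_tensor_left_hom, BraidedCategory.braiding_tensor_right_hom,
        BraidedCategory.braiding_tensor_right_hom]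
      monoidal
    _ = 𝟙 _ ⊗≫ U ◁ ((β_ U' V').hom ▷ V ⊗≫ V' ◁ (β_ U' V).hom ⊗≫ (β_ V' V).hom ▷ U') ⊗≫
          (((β_ U V).hom ≫ ε_ U V) ▷ (V' ⊗ U') ≫ 𝟙_ D ◁ ε_ U' V') ⊗≫ 𝟙 _ := by
      rw [h1]; monoidal
    _ = 𝟙 _ ⊗≫ U ◁ (β_ U' V').hom ▷ V ⊗≫ U ◁ (V' ◁ (β_ U' V).hom ⊗≫ (β_ V' V).hom ▷ U' ⊗≫
          V ◁ ε_ U' V' ⊗≫ 𝟙 (V ⊗ 𝟙_ D)) ⊗≫ ((β_ U V).hom ≫ ε_ U V) ⊗≫ 𝟙 _ := by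
      rw [← whisker_exchange]; monoidal
    _ = 𝟙 _ ⊗≫ U ◁ (β_ U' V').hom ▷ V ⊗≫ U ◁ (((α_ V' U' V).hom ≫
          V' ◁ (β_ U' V).hom ≫ (α_ V' V U').inv ≫ (β_ V' V).hom ▷ U' ≫ (α_ V V' U').hom) ≫
          V ◁ ε_ U' V') ⊗≫ ((β_ U V).hom ≫ ε_ U V) ⊗≫ 𝟙 _ := by monoidal
    _ = _ := by rw [← h2]; monoidal

theorem dualTrace_tensor {X Y U U' : D} (V V' : D) [ExactPairing U V] [ExactPairing U' V']
    (g : X ⊗ (U ⊗ U') ⟶ Y ⊗ (U ⊗ U')) :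
    dualTrace (U ⊗ U') (V' ⊗ V) g =
      dualTrace U V (dualTrace U' V' ((α_ X U U').hom ≫ g ≫ (α_ Y U U').inv)) := by
  rw [dualTrace, dualTrace, dualTrace, pairTrace_pairTrace, braiding_evaluation_tensor,
    ExactPairing.tensor_coevaluation]

theorem dualTrace_unit {X Y : D} (f : X ⊗ 𝟙_ D ⟶ Y ⊗ 𝟙_ D) :
    dualTrace (𝟙_ D) (𝟙_ D) f = (ρ_ X).inv ≫ f ≫ (ρ_ Y).hom := by
  have h1 : η_ (𝟙_ D) (𝟙_ D) = (ρ_ _).inv := rfl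
  have h2 : ε_ (𝟙_ D) (𝟙_ D) = (ρ_ _).hom := rfl
  rw [dualTrace, pairTrace, h1, h2, braiding_tensorUnit_left]
  monoidal

theorem dualTrace_yanking (U V : D) [ExactPairing U V] : dualTrace U V (β_ U U).hom = 𝟙 U := by
  rw [dualTrace, pairTrace, MonoidalCategory.whiskerLeft_comp]
  have h := BraidedCategory.hexagon_forward U U V
  calc
    _ = (ρ_ U).inv ≫ U ◁ η_ U V ≫ (α_ U U V).inv ≫ ((β_ U U).hom ▷ V ≫ (α_ U U V).hom ≫
          U ◁ (β_ U V).hom) ≫ U ◁ ε_ U V ≫ (ρ_ U).hom := by simp only [Category.assoc]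
    _ = (ρ_ U).inv ≫ (U ◁ η_ U V ≫ (β_ U (U ⊗ V)).hom) ≫ (α_ U V U).hom ≫ U ◁ ε_ U V ≫
          (ρ_ U).hom := by rw [← h]; simp only [Category.assoc, Iso.inv_hom_id_assoc]
    _ = (ρ_ U).inv ≫ (β_ U (𝟙_ D)).hom ≫ (η_ U V ▷ U ≫ (α_ U V U).hom ≫ U ◁ ε_ U V) ≫
          (ρ_ U).hom := by
      rw [BraidedCategory.braiding_naturality_right]; simp only [Category.assoc]
    _ = 𝟙 U := by
      rw [ExactPairing.evaluation_coevaluation, braiding_tensorUnit_right]; simp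

theorem canonicalTrace_eq [RightRigidCategory D] {X Y U : D} (V : D) [ExactPairing U V]
    (f : X ⊗ U ⟶ Y ⊗ U) : canonicalTrace D U f = Part.some (dualTrace U V f) := by
  rw [← dualTrace_eq (Uᘁ) V]; rfl

theorem isTotalTrace_canonicalTrace [RightRigidCategory D] : IsTotalTrace (canonicalTrace D) where
  naturality {X X' Y Y' U} f g h k hk := by
    obtain rfl := Part.mem_some_iff.1 hk
    exact Part.mem_some_iff.2 (pairTrace_naturality _ _ f g h).symm
  dinaturality f g := congrArg Part.some (dualTrace_dinaturality f g)
  vanishing_unit f := by rw [canonicalTrace_eq (𝟙_ D), dualTrace_unit]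
  vanishing_tensor {X Y U V} g k hk := by
    obtain rfl := Part.mem_some_iff.1 hk
    rw [canonicalTrace_eq (Vᘁ ⊗ Uᘁ), dualTrace_tensor]; rfl
  superposing {X Y U W Z} f g k hk := by
    obtain rfl := Part.mem_some_iff.1 hk
    exact Part.mem_some_iff.2 (pairTrace_superposing _ _ f g).symm
  yanking U := congrArg Part.some (dualTrace_yanking U (Uᘁ))
  total _ := trivial

end Compact

/-! ### The operation induced along a faithful functor -/

section Induced

open Functor.LaxMonoidal Functor.OplaxMonoidal

variable {C : Type u₁} [Category.{v₁} C] [MonoidalCategory C] [SymmetricCategory C]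
  {D : Type u₂} [Category.{v₂} D] [MonoidalCategory D] [SymmetricCategory D]
  (t : PartialTraceOp D) (F : C ⥤ D) [F.Braided]

/-- The operation induced along `F`: the trace of `f` is defined when the trace of
`m⁻¹ ∘ F f ∘ m` is defined and lies in the image of `F`. -/
noncomputable def inducedTrace : PartialTraceOp C := fun X Y U f =>
  ⟨∃ g : X ⟶ Y, F.map g ∈ t (F.obj U) (μ F X U ≫ F.map f ≫ δ F Y U), fun h => h.choose⟩

theorem isInducedTrace_inducedTrace [F.Faithful] : IsInducedTrace F t (inducedTrace t F) := by
  intro X Y U f g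
  constructor
  · rintro ⟨h, rfl⟩
    exact h.choose_spec
  · intro hg
    have h : ∃ g : X ⟶ Y, F.map g ∈ t (F.obj U) (μ F X U ≫ F.map f ≫ δ F Y U) := ⟨g, hg⟩
    exact ⟨h, F.map_injective (Part.mem_unique h.choose_spec hg)⟩

theorem IsInducedTrace.unique {t : PartialTraceOp D} {F : C ⥤ D} [F.Braided]
    {T T' : PartialTraceOp C} (h : IsInducedTrace F t T) (h' : IsInducedTrace F t T') : T = T' := by
  funext X Y U f
  exact Part.ext fun g => (h f g).trans (h' f g).symm

variable {t F} {T : PartialTraceOp C}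

theorem IsInducedTrace.isPartialTrace [F.Faithful] (hT : IsInducedTrace F t T)
    (ht : IsPartialTrace t) : IsPartialTrace T where
  naturality {X X' Y Y' U} f g h k hk := by
    rw [hT] at hk ⊢
    have := ht.naturality _ (F.map g) (F.map h) _ hk
    simpa using this
  dinaturality {X Y U U'} f g := by
    refine Part.ext fun k => ?_
    rw [hT, hT]
    have := ht.dinaturality (μ F X U ≫ F.map f ≫ δ F Y U') (F.map g)
    simp only [Category.assoc, δ_natural_right, μ_natural_right_assoc] at this
    simp only [Functor.map_comp, Category.assoc, this]
  vanishing_unit {X Y} f := by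
    refine Part.ext fun k => ?_
    rw [hT, Part.mem_some_iff]
    -- The trace over `F 𝟙` is the trace over `𝟙`, by dinaturality in `η F : F 𝟙 ⟶ 𝟙`.
    have h1 := ht.dinaturality (F.obj X ◁ ε F ≫ μ F X _ ≫ F.map f ≫ δ F Y _) (η F)
    rw [← MonoidalCategory.whiskerLeft_comp_assoc, Functor.Monoidal.η_ε,
      MonoidalCategory.whiskerLeft_id, Category.id_comp, ht.vanishing_unit] at h1
    rw [← h1, Part.mem_some_iff]
    have h2 : (ρ_ (F.obj X)).inv ≫ ((F.obj X ◁ ε F ≫ μ F X (𝟙_ C) ≫ F.map f ≫ δ F Y (𝟙_ C)) ≫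
        F.obj Y ◁ η F) ≫ (ρ_ (F.obj Y)).hom = F.map ((ρ_ X).inv ≫ f ≫ (ρ_ Y).hom) := by
      simp
    rw [h2]
    exact F.map_injective.eq_iff
  vanishing_tensor {X Y U V} g k hk := by
    refine Part.ext fun l => ?_
    rw [hT] at hk
    rw [hT, hT]
    have h1 := ht.naturality _ (μ F X U) (δ F Y U) _ hk
    set G := F.obj X ◁ μ F U V ≫ (μ F X (U ⊗ V) ≫ F.map g ≫ δ F Y (U ⊗ V)) ≫
      F.obj Y ◁ δ F U V with hG
    have h2 : μ F X U ▷ F.obj V ≫ (μ F (X ⊗ U) V ≫ F.map ((α_ X U V).hom ≫ g ≫ (α_ Y U V).inv) ≫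
        δ F (Y ⊗ U) V) ≫ δ F Y U ▷ F.obj V = (α_ _ _ _).hom ≫ G ≫ (α_ _ _ _).inv := by
      simp [hG]
    rw [h2] at h1
    rw [← ht.vanishing_tensor _ _ h1]
    -- The trace over `F (U ⊗ V)` is the trace over `F U ⊗ F V`, by dinaturality in `δ F U V`.
    have h3 := ht.dinaturality (F.obj X ◁ μ F U V ≫ (μ F X (U ⊗ V) ≫ F.map g ≫ δ F Y (U ⊗ V)))
      (δ F U V)
    rw [← MonoidalCategory.whiskerLeft_comp_assoc, Functor.Monoidal.δ_μ,
      MonoidalCategory.whiskerLeft_id, Category.id_comp, Category.assoc, ← hG] at h3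
    rw [h3]
  superposing {X Y U W Z} f g k hk := by
    rw [hT] at hk ⊢
    have h1 := ht.naturality _ (δ F W X) (μ F Z Y) _ (ht.superposing _ (F.map g) _ hk)
    simp only [Functor.LaxMonoidal.μ_natural, Functor.Monoidal.δ_μ_assoc] at h1
    convert h1 using 2
    simp only [MonoidalCategory.tensorHom_def, Functor.map_comp, Functor.Monoidal.map_associator,
      Functor.Monoidal.map_associator_inv, Functor.Monoidal.map_whiskerRight,
      Functor.Monoidal.map_whiskerLeft, Category.assoc, Functor.Monoidal.μ_δ_assoc,
      Functor.Monoidal.μ_δ, Category.comp_id, MonoidalCategory.whiskerLeft_comp]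
    rw [whisker_exchange_assoc]
  yanking U := by
    refine Part.ext fun k => ?_
    rw [hT, Functor.map_braiding]
    simp only [Category.assoc, Functor.Monoidal.μ_δ_assoc, Functor.Monoidal.μ_δ, Category.comp_id,
      ht.yanking, Part.mem_some_iff]
    rw [← F.map_id]
    exact F.map_injective.eq_iff

end Induced

/-! ### Operations on a family of presheaves -/

/-- A family of presheaves on `E`, indexed by `ι`. -/
structure PresheafFamily (E : Type u) [Category.{v} E] (ι : Type w') where
  /-- The values of the presheaves. -/
  obj : ι → E → Type w
  /-- Restriction along a morphism. -/
  map : ∀ {i : ι} {A B : E}, (A ⟶ B) → obj i B → obj i A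
  map_id : ∀ {i : ι} {A : E} (θ : obj i A), map (𝟙 A) θ = θ
  map_map : ∀ {i : ι} {A B B' : E} (f : A ⟶ B) (g : B ⟶ B') (θ : obj i B'),
    map f (map g θ) = map (f ≫ g) θ

section Cayley

variable {E : Type u} [Category.{v} E] [MonoidalCategory E] {ι : Type w'}

/-- A morphism from `A` to `B` that is known only through its contravariant action on the
presheaves of `O`, next to a spectator `R`: a family of maps `O (R ⊗ B) → O (R ⊗ A)`, natural
in `R`. -/
@[ext]
structure Transformation (O : PresheafFamily.{u, v, w, w'} E ι) (A B : E) where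
  /-- The action next to `R`. -/
  app : ∀ (i : ι) (R : E), O.obj i (R ⊗ B) → O.obj i (R ⊗ A)
  natural : ∀ {i : ι} {R R' : E} (r : R ⟶ R') (θ : O.obj i (R' ⊗ B)),
    app i R (O.map (r ▷ B) θ) = O.map (r ▷ A) (app i R' θ)

/-- The category with the objects of `E` and the transformations as morphisms. It represents
morphisms by their action on the presheaves, as Cayley's theorem represents the elements of a
group by permutations. -/
def Cayley (_ : PresheafFamily.{u, v, w, w'} E ι) : Type u := E

variable {O : PresheafFamily.{u, v, w, w'} E ι}

instance : Category (Cayley O) where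
  Hom A B := Transformation O A B
  id A := ⟨fun _ _ θ => θ, fun _ _ => rfl⟩
  comp φ ψ := ⟨fun i R θ => φ.app i R (ψ.app i R θ), fun r θ => by rw [ψ.natural, φ.natural]⟩

namespace Cayley

variable (O) in
/-- The identity-on-objects functor by which morphisms of `E` act by restriction. It is in general
neither full nor faithful. -/
def lift : E ⥤ Cayley O where
  obj A := A
  map {A B} e :=
    { app := fun _ R θ => O.map (R ◁ e) θ
      natural := fun r θ => by rw [O.map_map, O.map_map, whisker_exchange] }
  map_id A := Transformation.ext <| by
    funext i R θ
    simp only [MonoidalCategory.whiskerLeft_id]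
    exact O.map_id θ
  map_comp e e' := Transformation.ext <| by
    funext i R θ
    simp only [MonoidalCategory.whiskerLeft_comp]
    exact (O.map_map _ _ θ).symm

/-- The action of a morphism at a spectator `R`. -/
def app {A B : E} (φ : (lift O).obj A ⟶ (lift O).obj B) {i : ι} (R : E)
    (θ : O.obj i (R ⊗ B)) : O.obj i (R ⊗ A) := Transformation.app φ i R θ

theorem app_natural {A B : E} (φ : (lift O).obj A ⟶ (lift O).obj B) {i : ι} {R R' : E}
    (r : R ⟶ R') (θ : O.obj i (R' ⊗ B)) :
    app φ R (O.map (r ▷ B) θ) = O.map (r ▷ A) (app φ R' θ) := Transformation.natural φ r θ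

theorem hom_ext {A B : E} {φ ψ : (lift O).obj A ⟶ (lift O).obj B}
    (h : ∀ (i : ι) (R : E) (θ : O.obj i (R ⊗ B)), app φ R θ = app ψ R θ) : φ = ψ :=
  Transformation.ext <| by funext i R θ; exact h i R θ

theorem app_id {A : E} {i : ι} (R : E) (θ : O.obj i (R ⊗ A)) :
    app (𝟙 ((lift O).obj A)) R θ = θ := rfl

theorem app_comp {A B B' : E} (φ : (lift O).obj A ⟶ (lift O).obj B)
    (ψ : (lift O).obj B ⟶ (lift O).obj B') {i : ι} (R : E) (θ : O.obj i (R ⊗ B')) :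
    app (φ ≫ ψ) R θ = app φ R (app ψ R θ) := rfl

theorem app_lift {A B : E} (e : A ⟶ B) {i : ι} (R : E) (θ : O.obj i (R ⊗ B)) :
    app ((lift O).map e) R θ = O.map (R ◁ e) θ := rfl

/-- Tensoring a transformation with an object on the left: the object joins the spectator. -/
def wl (X : E) {A B : E} (φ : (lift O).obj A ⟶ (lift O).obj B) :
    (lift O).obj (X ⊗ A) ⟶ (lift O).obj (X ⊗ B) :=
  Transformation.mk (O := O) (A := X ⊗ A) (B := X ⊗ B)
    (fun _ R θ => O.map (α_ R X A).inv (app φ (R ⊗ X) (O.map (α_ R X B).hom θ)))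
    (fun {i R R'} r θ => by
      rw [O.map_map, ← associator_naturality_left, ← O.map_map, app_natural, O.map_map, O.map_map,
        associator_inv_naturality_left])

theorem app_wl (X : E) {A B : E} (φ : (lift O).obj A ⟶ (lift O).obj B) {i : ι} (R : E)
    (θ : O.obj i (R ⊗ (X ⊗ B))) :
    app (wl X φ) R θ = O.map (α_ R X A).inv (app φ (R ⊗ X) (O.map (α_ R X B).hom θ)) := rfl

theorem wl_id (X A : E) : wl X (𝟙 ((lift O).obj A)) = 𝟙 _ := by
  refine hom_ext fun i R θ => ?_
  rw [app_wl, app_id, app_id, O.map_map, Iso.inv_hom_id, O.map_id]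

theorem wl_comp (X : E) {A B B' : E} (φ : (lift O).obj A ⟶ (lift O).obj B)
    (ψ : (lift O).obj B ⟶ (lift O).obj B') : wl X (φ ≫ ψ) = wl X φ ≫ wl X ψ := by
  refine hom_ext fun i R θ => ?_
  rw [app_wl, app_comp, app_comp, app_wl, app_wl, O.map_map _ _ (app ψ _ _), Iso.hom_inv_id,
    O.map_id]

theorem wl_lift (X : E) {A B : E} (e : A ⟶ B) :
    wl X ((lift O).map e) = (lift O).map (X ◁ e) := by
  refine hom_ext fun i R θ => ?_
  rw [app_wl, app_lift, app_lift, O.map_map, O.map_map]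
  congr 1
  monoidal

theorem wl_unit {A B : E} (φ : (lift O).obj A ⟶ (lift O).obj B) :
    wl (𝟙_ E) φ ≫ (lift O).map (λ_ B).hom = (lift O).map (λ_ A).hom ≫ φ := by
  refine hom_ext fun i R θ => ?_
  rw [app_comp, app_comp, app_wl, app_lift, app_lift, O.map_map]
  have h : (α_ R (𝟙_ E) B).hom ≫ R ◁ (λ_ B).hom = (ρ_ R).hom ▷ B := by simp
  rw [h, app_natural, O.map_map]
  congr 1
  simp

theorem wl_tensor (X Y : E) {A B : E} (φ : (lift O).obj A ⟶ (lift O).obj B) :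
    wl (X ⊗ Y) φ ≫ (lift O).map (α_ X Y B).hom =
      (lift O).map (α_ X Y A).hom ≫ wl X (wl Y φ) := by
  refine hom_ext fun i R θ => ?_
  rw [app_comp, app_comp, app_wl, app_wl, app_wl, app_lift, app_lift, O.map_map, O.map_map]
  have h : (α_ R (X ⊗ Y) B).hom ≫ R ◁ (α_ X Y B).hom =
      (α_ R X Y).inv ▷ B ≫ (α_ (R ⊗ X) Y B).hom ≫ (α_ R X (Y ⊗ B)).hom := by monoidal
  rw [h, ← O.map_map, app_natural, O.map_map, O.map_map, O.map_map]
  congr 1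
  monoidal

theorem wl_natural {X Y : E} (h : X ⟶ Y) {A B : E} (φ : (lift O).obj A ⟶ (lift O).obj B) :
    (lift O).map (h ▷ A) ≫ wl Y φ = wl X φ ≫ (lift O).map (h ▷ B) := by
  refine hom_ext fun i R θ => ?_
  rw [app_comp, app_comp, app_wl, app_wl, app_lift, app_lift, O.map_map, O.map_map]
  rw [← associator_naturality_middle, ← O.map_map _ _ θ, app_natural, O.map_map]
  congr 1
  monoidal

theorem wl_wl (X Y : E) {A B : E} (φ : (lift O).obj A ⟶ (lift O).obj B) :
    wl X (wl Y φ) =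
      (lift O).map (α_ X Y A).inv ≫ wl (X ⊗ Y) φ ≫ (lift O).map (α_ X Y B).hom := by
  rw [wl_tensor, ← Functor.map_comp_assoc, Iso.inv_hom_id, CategoryTheory.Functor.map_id,
    Category.id_comp]

variable [SymmetricCategory E]

/-- Tensoring a transformation with an object on the right. -/
def wr {A B : E} (φ : (lift O).obj A ⟶ (lift O).obj B) (X : E) :
    (lift O).obj (A ⊗ X) ⟶ (lift O).obj (B ⊗ X) :=
  (lift O).map (β_ A X).hom ≫ wl X φ ≫ (lift O).map (β_ X B).hom

theorem wr_id (A X : E) : wr (𝟙 ((lift O).obj A)) X = 𝟙 _ := by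
  rw [wr, wl_id, Category.id_comp, ← Functor.map_comp, SymmetricCategory.symmetry,
    CategoryTheory.Functor.map_id]

theorem lift_braiding_wl (X : E) {A B : E} (φ : (lift O).obj A ⟶ (lift O).obj B) :
    (lift O).map (β_ A X).hom ≫ wl X φ = wr φ X ≫ (lift O).map (β_ B X).hom := by
  rw [wr, Category.assoc, Category.assoc, ← Functor.map_comp, SymmetricCategory.symmetry,
    CategoryTheory.Functor.map_id, Category.comp_id]

theorem lift_braiding_wr (X : E) {A B : E} (φ : (lift O).obj A ⟶ (lift O).obj B) :
    (lift O).map (β_ X A).hom ≫ wr φ X = wl X φ ≫ (lift O).map (β_ X B).hom := by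
  rw [wr, ← Functor.map_comp_assoc, SymmetricCategory.symmetry,
    CategoryTheory.Functor.map_id, Category.id_comp]

theorem wr_comp {A B B' : E} (φ : (lift O).obj A ⟶ (lift O).obj B)
    (ψ : (lift O).obj B ⟶ (lift O).obj B') (X : E) : wr (φ ≫ ψ) X = wr φ X ≫ wr ψ X := by
  rw [wr, wr, Category.assoc, Category.assoc, lift_braiding_wr, wl_comp, Category.assoc]

theorem wr_lift {A B : E} (e : A ⟶ B) (X : E) :
    wr ((lift O).map e) X = (lift O).map (e ▷ X) := by
  rw [wr, wl_lift, ← Functor.map_comp, ← Functor.map_comp]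
  simp

theorem wr_unit {A B : E} (φ : (lift O).obj A ⟶ (lift O).obj B) :
    wr φ (𝟙_ E) ≫ (lift O).map (ρ_ B).hom = (lift O).map (ρ_ A).hom ≫ φ := by
  rw [wr, Category.assoc, Category.assoc, ← Functor.map_comp, braiding_rightUnitor, wl_unit,
    ← Functor.map_comp_assoc, braiding_leftUnitor]

theorem wr_wl (X Y : E) {A B : E} (φ : (lift O).obj A ⟶ (lift O).obj B) :
    wr (wl X φ) Y ≫ (lift O).map (α_ X B Y).hom =
      (lift O).map (α_ X A Y).hom ≫ wl X (wr φ Y) := by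
  have h1 : (β_ (X ⊗ A) Y).hom ≫ (α_ Y X A).inv =
      ((α_ X A Y).hom ≫ X ◁ (β_ A Y).hom ≫ (α_ X Y A).inv) ≫ (β_ X Y).hom ▷ A := by
    rw [Category.assoc, Category.assoc, ← BraidedCategory.hexagon_reverse, Iso.hom_inv_id_assoc]
  have h2 : (β_ X Y).hom ▷ B ≫ (α_ Y X B).hom ≫ (β_ Y (X ⊗ B)).hom ≫ (α_ X B Y).hom =
      (α_ X Y B).hom ≫ X ◁ (β_ Y B).hom := by
    rw [BraidedCategory.hexagon_forward, ← comp_whiskerRight_assoc, SymmetricCategory.symmetry,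
      id_whiskerRight, Category.id_comp]
  calc
    _ = (lift O).map ((β_ (X ⊗ A) Y).hom ≫ (α_ Y X A).inv) ≫ wl (Y ⊗ X) φ ≫
          (lift O).map ((α_ Y X B).hom ≫ (β_ Y (X ⊗ B)).hom ≫ (α_ X B Y).hom) := by
      rw [wr, wl_wl]; simp only [Functor.map_comp, Category.assoc]
    _ = (lift O).map ((α_ X A Y).hom ≫ X ◁ (β_ A Y).hom ≫ (α_ X Y A).inv) ≫ wl (X ⊗ Y) φ ≫
          (lift O).map ((β_ X Y).hom ▷ B ≫ (α_ Y X B).hom ≫ (β_ Y (X ⊗ B)).hom ≫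
            (α_ X B Y).hom) := by
      rw [h1, Functor.map_comp, Category.assoc, ← Category.assoc _ (wl (Y ⊗ X) φ), wl_natural]
      simp only [Functor.map_comp, Category.assoc]
    _ = _ := by
      rw [h2, wr, wl_comp, wl_comp, wl_lift, wl_lift, wl_wl]
      simp only [Functor.map_comp, Category.assoc]

theorem wr_wr (X Y : E) {A B : E} (φ : (lift O).obj A ⟶ (lift O).obj B) :
    wr (wr φ X) Y ≫ (lift O).map (α_ B X Y).hom =
      (lift O).map (α_ A X Y).hom ≫ wr φ (X ⊗ Y) := by
  have h1 : (α_ A X Y).hom ≫ (β_ A (X ⊗ Y)).hom = (β_ A X).hom ▷ Y ≫ (α_ X A Y).hom ≫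
      X ◁ (β_ A Y).hom ≫ (α_ X Y A).inv := by
    rw [← BraidedCategory.hexagon_forward_assoc, Iso.hom_inv_id, Category.comp_id]
  have h2 : (α_ X Y B).hom ≫ X ◁ (β_ Y B).hom ≫ (α_ X B Y).inv ≫ (β_ X B).hom ▷ Y ≫
      (α_ B X Y).hom = (β_ (X ⊗ Y) B).hom := by
    rw [← BraidedCategory.hexagon_reverse_assoc, Iso.inv_hom_id, Category.comp_id,
      Iso.hom_inv_id_assoc]
  have h3 : wr (wl X φ) Y = (lift O).map (α_ X A Y).hom ≫ wl X (wr φ Y) ≫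
      (lift O).map (α_ X B Y).inv := by
    rw [← Category.assoc, ← wr_wl, Category.assoc, ← Functor.map_comp, Iso.hom_inv_id,
      CategoryTheory.Functor.map_id, Category.comp_id]
  calc
    _ = (lift O).map ((β_ A X).hom ▷ Y ≫ (α_ X A Y).hom ≫ X ◁ (β_ A Y).hom ≫
          (α_ X Y A).inv) ≫ wl (X ⊗ Y) φ ≫ (lift O).map ((α_ X Y B).hom ≫ X ◁ (β_ Y B).hom ≫
          (α_ X B Y).inv ≫ (β_ X B).hom ▷ Y ≫ (α_ B X Y).hom) := by
      have h4 : wr φ X = (lift O).map (β_ A X).hom ≫ wl X φ ≫ (lift O).map (β_ X B).hom := rfl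
      rw [h4, wr_comp, wr_comp, wr_lift, wr_lift, h3, wr, wl_comp, wl_comp, wl_lift, wl_lift,
        wl_wl]
      simp only [Functor.map_comp, Category.assoc]
    _ = _ := by
      rw [← h1, h2, wr]
      simp only [Functor.map_comp, Category.assoc]

/-- The exchange law for `φ` and `ψ`. It is not automatic: `Cayley O` is only a premonoidal
category. -/
def Commute {A B X Y : E} (φ : (lift O).obj A ⟶ (lift O).obj B)
    (ψ : (lift O).obj X ⟶ (lift O).obj Y) : Prop :=
  wl A ψ ≫ wr φ Y = wr φ X ≫ wl B ψ

theorem Commute.symm {A B X Y : E} {φ : (lift O).obj A ⟶ (lift O).obj B}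
    {ψ : (lift O).obj X ⟶ (lift O).obj Y} (h : Commute φ ψ) : Commute ψ φ := by
  unfold Commute at *
  calc
    _ = (lift O).map (β_ X A).hom ≫ (wr φ X ≫ wl B ψ) ≫ (lift O).map (β_ B Y).hom := by
      rw [Category.assoc, reassoc_of% (lift_braiding_wr X φ)]; rfl
    _ = _ := by
      rw [← h, Category.assoc, reassoc_of% (lift_braiding_wl A ψ),
        reassoc_of% (lift_braiding_wr Y φ), ← Functor.map_comp, SymmetricCategory.symmetry,
        CategoryTheory.Functor.map_id, Category.comp_id]

theorem Commute.lift_left {A B X Y : E} (e : A ⟶ B) (ψ : (lift O).obj X ⟶ (lift O).obj Y) :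
    Commute ((lift O).map e) ψ := by
  rw [Commute, wr_lift, wr_lift, wl_natural]

theorem Commute.comp_left {A B B' X Y : E} {φ : (lift O).obj A ⟶ (lift O).obj B}
    {φ' : (lift O).obj B ⟶ (lift O).obj B'} {ψ : (lift O).obj X ⟶ (lift O).obj Y}
    (h : Commute φ ψ) (h' : Commute φ' ψ) : Commute (φ ≫ φ') ψ := by
  unfold Commute at *
  rw [wr_comp, wr_comp, reassoc_of% h, h', Category.assoc]

theorem Commute.wl_left (Z : E) {A B X Y : E} {φ : (lift O).obj A ⟶ (lift O).obj B}
    {ψ : (lift O).obj X ⟶ (lift O).obj Y} (h : Commute φ ψ) : Commute (wl Z φ) ψ := by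
  unfold Commute at *
  have e1 : ∀ Y, wr (wl Z φ) Y = (lift O).map (α_ Z A Y).hom ≫ wl Z (wr φ Y) ≫
      (lift O).map (α_ Z B Y).inv := fun Y => by
    rw [← Category.assoc, ← wr_wl, Category.assoc, ← Functor.map_comp, Iso.hom_inv_id,
      CategoryTheory.Functor.map_id, Category.comp_id]
  have e2 : wl Z (wl B ψ) ≫ (lift O).map (α_ Z B Y).inv =
      (lift O).map (α_ Z B X).inv ≫ wl (Z ⊗ B) ψ := by
    rw [wl_wl, Category.assoc, Category.assoc, ← Functor.map_comp, Iso.hom_inv_id,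
      CategoryTheory.Functor.map_id, Category.comp_id]
  rw [e1, e1, reassoc_of% (wl_tensor Z A ψ), ← Category.assoc (wl Z (wl A ψ)), ← wl_comp, h,
    wl_comp, Category.assoc, Category.assoc, Category.assoc, e2]

/-- The transformations generated from the morphisms of `E` and a class `S` by composition and by
tensoring with objects on the left; closure under tensoring on the right follows. -/
inductive Generated (S : ∀ ⦃A B : E⦄, ((lift O).obj A ⟶ (lift O).obj B) → Prop) :
    ∀ {A B : E}, ((lift O).obj A ⟶ (lift O).obj B) → Prop
  | base {A B : E} (e : A ⟶ B) : Generated S ((lift O).map e)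
  | of {A B : E} {φ : (lift O).obj A ⟶ (lift O).obj B} : S φ → Generated S φ
  | comp {A B B' : E} {φ : (lift O).obj A ⟶ (lift O).obj B}
      {ψ : (lift O).obj B ⟶ (lift O).obj B'} :
      Generated S φ → Generated S ψ → Generated S (φ ≫ ψ)
  | wl (X : E) {A B : E} {φ : (lift O).obj A ⟶ (lift O).obj B} :
      Generated S φ → Generated S (wl X φ)

theorem Generated.wr {S : ∀ ⦃A B : E⦄, ((lift O).obj A ⟶ (lift O).obj B) → Prop} {A B : E}
    {φ : (lift O).obj A ⟶ (lift O).obj B} (h : Generated S φ) (X : E) :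
    Generated S (wr φ X) := .comp (.base _) (.comp (.wl X h) (.base _))

/-- The exchange law passes from a class `S` to the transformations that it generates. -/
theorem Generated.commute {S : ∀ ⦃A B : E⦄, ((lift O).obj A ⟶ (lift O).obj B) → Prop}
    (hS : ∀ {A B X Y : E} (φ : (lift O).obj A ⟶ (lift O).obj B)
      (ψ : (lift O).obj X ⟶ (lift O).obj Y), S φ → S ψ → Commute φ ψ)
    {A B X Y : E} {φ : (lift O).obj A ⟶ (lift O).obj B}
    {ψ : (lift O).obj X ⟶ (lift O).obj Y} (hφ : Generated S φ)
    (hψ : Generated S ψ) : Commute φ ψ := by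
  induction hφ with
  | base e => exact .lift_left e ψ
  | @of A B φ h =>
    refine Commute.symm ?_
    induction hψ with
    | base e => exact .lift_left e φ
    | of h' => exact hS _ _ h' h
    | comp _ _ h₁ h₂ => exact .comp_left h₁ h₂
    | wl X _ h => exact .wl_left X h
  | comp _ _ h₁ h₂ => exact .comp_left h₁ h₂
  | wl X _ h => exact .wl_left X h

end Cayley

variable [SymmetricCategory E]

/-! ### The symmetric monoidal category generated by a commuting class -/

/-- A class of transformations any two of which satisfy the exchange law. -/
structure CommutingClass (O : PresheafFamily.{u, v, w, w'} E ι) where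
  /-- Membership in the class. -/
  mem : ∀ ⦃A B : E⦄, ((Cayley.lift O).obj A ⟶ (Cayley.lift O).obj B) → Prop
  commute : ∀ {A B X Y : E} (φ : (Cayley.lift O).obj A ⟶ (Cayley.lift O).obj B)
    (ψ : (Cayley.lift O).obj X ⟶ (Cayley.lift O).obj Y), mem φ → mem ψ → Cayley.Commute φ ψ

/-- The category with the objects of `E` and the transformations generated by a commuting class
as morphisms. -/
structure Extension (S : CommutingClass O) : Type u where
  /-- The underlying object of `E`. -/
  of : E

namespace Extension

open Cayley

variable {S : CommutingClass O}

instance : Category (Extension S) where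
  Hom A B := {φ : (lift O).obj A.of ⟶ (lift O).obj B.of // Generated S.mem φ}
  id A := ⟨𝟙 ((lift O).obj A.of), by
    rw [← CategoryTheory.Functor.map_id]; exact .base _⟩
  comp φ ψ := ⟨φ.1 ≫ ψ.1, .comp φ.2 ψ.2⟩

variable (S) in
/-- The identity-on-objects functor from `E` to its extension. The structural isomorphisms of the
extension are its values on those of `E`, so that it is a strict symmetric monoidal functor. -/
def incl : E ⥤ Extension S where
  obj A := ⟨A⟩
  map e := ⟨(lift O).map e, .base e⟩
  map_id A := Subtype.ext ((lift O).map_id A)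
  map_comp e e' := Subtype.ext ((lift O).map_comp e e')

instance : MonoidalCategoryStruct (Extension S) where
  tensorObj A B := ⟨A.of ⊗ B.of⟩
  whiskerLeft X _ _ φ := ⟨wl X.of φ.1, .wl X.of φ.2⟩
  whiskerRight φ X := ⟨wr φ.1 X.of, φ.2.wr X.of⟩
  tensorHom {_ B X _} φ ψ := ⟨wr φ.1 X.of ≫ wl B.of ψ.1, .comp (φ.2.wr X.of) (.wl B.of ψ.2)⟩
  tensorUnit := ⟨𝟙_ E⟩
  associator A B X := (incl S).mapIso (α_ A.of B.of X.of)
  leftUnitor A := (incl S).mapIso (λ_ A.of)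
  rightUnitor A := (incl S).mapIso (ρ_ A.of)

theorem commute {A B X Y : E} (φ : {φ : (lift O).obj A ⟶ (lift O).obj B // Generated S.mem φ})
    (ψ : {φ : (lift O).obj X ⟶ (lift O).obj Y // Generated S.mem φ}) :
    wl A ψ.1 ≫ wr φ.1 Y = wr φ.1 X ≫ wl B ψ.1 :=
  Generated.commute S.commute φ.2 ψ.2

theorem assoc_natural {A A' B B' X X' : E} (φ : (lift O).obj A ⟶ (lift O).obj A')
    (ψ : (lift O).obj B ⟶ (lift O).obj B') (χ : (lift O).obj X ⟶ (lift O).obj X') :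
    (wr (wr φ B ≫ wl A' ψ) X ≫ wl (A' ⊗ B') χ) ≫ (lift O).map (α_ A' B' X').hom =
      (lift O).map (α_ A B X).hom ≫ wr φ (B ⊗ X) ≫ wl A' (wr ψ X ≫ wl B' χ) := by
  rw [wr_comp, wl_comp, Category.assoc, Category.assoc, wl_tensor, reassoc_of% wr_wl,
    reassoc_of% wr_wr]

instance : MonoidalCategory (Extension S) where
  tensorHom_def _ _ := rfl
  id_tensorHom_id A B := Subtype.ext <| by
    change wr (𝟙 ((lift O).obj A.of)) B.of ≫ wl A.of (𝟙 ((lift O).obj B.of)) = 𝟙 _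
    rw [wr_id, wl_id, Category.id_comp]
  tensorHom_comp_tensorHom {A A' A'' B B' B''} f₁ f₂ g₁ g₂ := Subtype.ext <| by
    change (wr f₁.1 B.of ≫ wl A'.of f₂.1) ≫ (wr g₁.1 B'.of ≫ wl A''.of g₂.1) =
      wr (f₁.1 ≫ g₁.1) B.of ≫ wl A''.of (f₂.1 ≫ g₂.1)
    rw [wr_comp, wl_comp, Category.assoc, reassoc_of% (commute g₁ f₂)]
    simp only [Category.assoc]
  whiskerLeft_id A B := Subtype.ext (wl_id A.of B.of)
  id_whiskerRight A B := Subtype.ext (wr_id A.of B.of)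
  associator_naturality f g h := Subtype.ext (assoc_natural f.1 g.1 h.1)
  leftUnitor_naturality f := Subtype.ext (wl_unit f.1)
  rightUnitor_naturality f := Subtype.ext (wr_unit f.1)
  pentagon A B X Y := Subtype.ext <| by
    change wr ((lift O).map (α_ A.of B.of X.of).hom) Y.of ≫
      (lift O).map (α_ A.of (B.of ⊗ X.of) Y.of).hom ≫
        wl A.of ((lift O).map (α_ B.of X.of Y.of).hom) =
      (lift O).map (α_ (A.of ⊗ B.of) X.of Y.of).hom ≫
        (lift O).map (α_ A.of B.of (X.of ⊗ Y.of)).hom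
    rw [wr_lift, wl_lift]
    simp only [← Functor.map_comp, MonoidalCategory.pentagon]
  triangle A B := Subtype.ext <| by
    change (lift O).map (α_ A.of (𝟙_ E) B.of).hom ≫ wl A.of ((lift O).map (λ_ B.of).hom) =
      wr ((lift O).map (ρ_ A.of).hom) B.of
    rw [wr_lift, wl_lift, ← Functor.map_comp, MonoidalCategory.triangle]

theorem incl_map_whiskerRight {A B : E} (e : A ⟶ B) (X : E) :
    (incl S).map (e ▷ X) = (incl S).map e ▷ (incl S).obj X := Subtype.ext (wr_lift e X).symm

theorem incl_map_whiskerLeft (X : E) {A B : E} (e : A ⟶ B) :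
    (incl S).map (X ◁ e) = (incl S).obj X ◁ (incl S).map e := Subtype.ext (wl_lift X e).symm

instance : SymmetricCategory (Extension S) where
  braiding A B := (incl S).mapIso (β_ A.of B.of)
  braiding_naturality_right X {Y Z} f := Subtype.ext (lift_braiding_wr X.of f.1).symm
  braiding_naturality_left {X Y} f Z := Subtype.ext (lift_braiding_wl Z.of f.1).symm
  hexagon_forward A B X := by
    have h := congrArg (incl S).map (BraidedCategory.hexagon_forward A.of B.of X.of)
    simp only [Functor.map_comp, incl_map_whiskerLeft, incl_map_whiskerRight] at h
    exact h
  hexagon_reverse A B X := by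
    have h := congrArg (incl S).map (BraidedCategory.hexagon_reverse A.of B.of X.of)
    simp only [Functor.map_comp, incl_map_whiskerLeft, incl_map_whiskerRight] at h
    exact h
  symmetry A B := ((incl S).map_comp _ _).symm.trans
    ((congrArg (incl S).map (SymmetricCategory.symmetry A.of B.of)).trans ((incl S).map_id _))

instance : (incl S).Braided where
  ε := 𝟙 _
  μ _ _ := 𝟙 _
  η := 𝟙 _
  δ _ _ := 𝟙 _
  μ_natural_left e X := by
    rw [incl_map_whiskerRight]; exact (Category.comp_id _).trans (Category.id_comp _).symm
  μ_natural_right X e := by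
    rw [incl_map_whiskerLeft]; exact (Category.comp_id _).trans (Category.id_comp _).symm
  associativity X Y Z := by
    refine (congrArg (· ≫ _) (id_whiskerRight _ _)).trans ?_
    refine Eq.trans ?_ (congrArg (_ ≫ ·) (congrArg (· ≫ _) (whiskerLeft_id _ _))).symm
    exact ((Category.id_comp _).trans (Category.id_comp _)).trans
      ((congrArg (_ ≫ ·) (Category.id_comp _)).trans (Category.comp_id _)).symm
  left_unitality X := ((congrArg (· ≫ (𝟙 _ ≫ (incl S).map (λ_ X).hom))
    (id_whiskerRight (𝟙_ (Extension S)) ((incl S).obj X))).trans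
    ((Category.id_comp _).trans (Category.id_comp _))).symm
  right_unitality X := ((congrArg (· ≫ (𝟙 _ ≫ (incl S).map (ρ_ X).hom))
    (whiskerLeft_id ((incl S).obj X) (𝟙_ (Extension S)))).trans
    ((Category.id_comp _).trans (Category.id_comp _))).symm
  δ_natural_left e X := by
    rw [incl_map_whiskerRight]; exact (Category.id_comp _).trans (Category.comp_id _).symm
  δ_natural_right X e := by
    rw [incl_map_whiskerLeft]; exact (Category.id_comp _).trans (Category.comp_id _).symm
  oplax_associativity X Y Z := by
    refine (congrArg (_ ≫ ·) (congrArg (· ≫ _) (id_whiskerRight _ _))).trans ?_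
    refine Eq.trans ?_ (congrArg (_ ≫ ·) (congrArg (_ ≫ ·) (whiskerLeft_id _ _))).symm
    exact ((Category.id_comp _).trans (Category.id_comp _)).trans
      ((congrArg (_ ≫ ·) (Category.id_comp _)).trans (Category.comp_id _)).symm
  oplax_left_unitality X := ((congrArg (_ ≫ ·) (congrArg (_ ≫ ·) (id_whiskerRight _ _))).trans
    ((congrArg (_ ≫ ·) (Category.id_comp _)).trans (Category.comp_id _))).symm
  oplax_right_unitality X := ((congrArg (_ ≫ ·) (congrArg (_ ≫ ·) (whiskerLeft_id _ _))).trans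
    ((congrArg (_ ≫ ·) (Category.id_comp _)).trans (Category.comp_id _))).symm
  ε_η := Category.comp_id _
  η_ε := Category.comp_id _
  μ_δ _ _ := Category.comp_id _
  δ_μ _ _ := Category.comp_id _
  braided X Y := (Category.id_comp _).trans (Category.comp_id _).symm

end Extension
end Cayley

/-! ### Cups and caps -/

namespace Cayley

variable {E : Type u} [Category.{v} E] [MonoidalCategory E] {ι : Type w'}
  {O : PresheafFamily.{u, v, w, w'} E ι}

variable (O) in
/-- A natural family of operations `O P → O (P ⊗ K)`. -/
structure CapOp (K : E) where
  /-- The operation. -/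
  op : ∀ {i : ι} {P : E}, O.obj i P → O.obj i (P ⊗ K)
  natural : ∀ {i : ι} {P Q : E} (f : P ⟶ Q) (θ : O.obj i Q),
    op (O.map f θ) = O.map (f ▷ K) (op θ)

/-- The transformation `K ⟶ 𝟙` of an operation `O P → O (P ⊗ K)`. -/
def CapOp.hom {K : E} (e : CapOp O K) : (lift O).obj K ⟶ (lift O).obj (𝟙_ E) :=
  Transformation.mk (O := O) (A := K) (B := 𝟙_ E)
    (fun _ R θ => e.op (O.map (ρ_ R).inv θ))
    (fun {i R R'} r θ => by
      rw [O.map_map, ← e.natural, O.map_map, rightUnitor_inv_naturality])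

theorem CapOp.app_hom {K : E} (e : CapOp O K) {i : ι} (R : E) (θ : O.obj i (R ⊗ 𝟙_ E)) :
    app e.hom R θ = e.op (O.map (ρ_ R).inv θ) := rfl

theorem CapOp.app_wl {K : E} (e : CapOp O K) (X : E) {i : ι} (R : E)
    (θ : O.obj i (R ⊗ (X ⊗ 𝟙_ E))) :
    app (wl X e.hom) R θ = O.map (α_ R X K).inv (e.op (O.map (R ◁ (ρ_ X).inv) θ)) := by
  rw [Cayley.app_wl, e.app_hom, O.map_map]
  congr 3
  monoidal

variable [SymmetricCategory E]

/-- The exchange of the first two factors of `K ⊗ (R ⊗ X)`. -/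
def swapLeft (K R X : E) : K ⊗ (R ⊗ X) ⟶ R ⊗ (K ⊗ X) :=
  (α_ K R X).inv ≫ (β_ K R).hom ▷ X ≫ (α_ R K X).hom

theorem swapLeft_unit (K R : E) :
    swapLeft K R (𝟙_ E) ≫ R ◁ (ρ_ K).hom = K ◁ (ρ_ R).hom ≫ (β_ K R).hom := by
  simp [swapLeft]

variable (O) in
/-- A natural family of operations `O (K ⊗ P) → O P`. -/
structure CupOp (K : E) where
  /-- The operation. -/
  op : ∀ {i : ι} {P : E}, O.obj i (K ⊗ P) → O.obj i P
  natural : ∀ {i : ι} {P Q : E} (f : P ⟶ Q) (θ : O.obj i (K ⊗ Q)),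
    op (O.map (K ◁ f) θ) = O.map f (op θ)

/-- The transformation `𝟙 ⟶ K` of an operation `O (K ⊗ P) → O P`. -/
def CupOp.hom {K : E} (s : CupOp O K) : (lift O).obj (𝟙_ E) ⟶ (lift O).obj K :=
  Transformation.mk (O := O) (A := 𝟙_ E) (B := K)
    (fun _ R θ => O.map (ρ_ R).hom (s.op (O.map (β_ K R).hom θ)))
    (fun {i R R'} r θ => by
      rw [O.map_map, O.map_map, MonoidalCategory.rightUnitor_naturality, ← O.map_map _ r,
        ← s.natural r, O.map_map, BraidedCategory.braiding_naturality_right])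

theorem CupOp.app_hom {K : E} (s : CupOp O K) {i : ι} (R : E) (θ : O.obj i (R ⊗ K)) :
    app s.hom R θ = O.map (ρ_ R).hom (s.op (O.map (β_ K R).hom θ)) := rfl

theorem CupOp.app_wl {K : E} (s : CupOp O K) (X : E) {i : ι} (R : E)
    (θ : O.obj i (R ⊗ (X ⊗ K))) :
    app (wl X s.hom) R θ =
      O.map (R ◁ (ρ_ X).hom) (s.op (O.map ((β_ K (R ⊗ X)).hom ≫ (α_ R X K).hom) θ)) := by
  rw [Cayley.app_wl, s.app_hom, O.map_map, O.map_map]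
  congr 1
  monoidal

theorem CupOp.app_wr {K : E} (s : CupOp O K) (X : E) {i : ι} (R : E)
    (θ : O.obj i (R ⊗ (K ⊗ X))) :
    app (wr s.hom X) R θ = O.map (R ◁ (λ_ X).hom) (s.op (O.map (swapLeft K R X) θ)) := by
  rw [wr, app_comp, app_comp, app_lift, app_lift, s.app_wl, O.map_map, O.map_map]
  congr 1
  · simp
  · congr 2
    simp only [BraidedCategory.braiding_tensor_right_hom, Category.assoc, Iso.inv_hom_id_assoc,
      swapLeft]
    rw [← MonoidalCategory.whiskerLeft_comp, SymmetricCategory.symmetry,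
      MonoidalCategory.whiskerLeft_id, Category.comp_id]

theorem CapOp.app_wr {K : E} (e : CapOp O K) (X : E) {i : ι} (R : E)
    (θ : O.obj i (R ⊗ (𝟙_ E ⊗ X))) :
    app (wr e.hom X) R θ =
      O.map (R ◁ (β_ K X).hom ≫ (α_ R X K).inv) (e.op (O.map (R ◁ (λ_ X).inv) θ)) := by
  rw [wr, app_comp, app_comp, app_lift, app_lift, e.app_wl, O.map_map, O.map_map]
  congr 3
  simp

theorem commute_cup_cup {K K' : E} (s : CupOp O K) (s' : CupOp O K')
    (h : ∀ {i : ι} {P : E} (θ : O.obj i (K' ⊗ (K ⊗ P))),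
      s.op (s'.op θ) = s'.op (s.op (O.map (swapLeft K K' P) θ))) :
    Commute s.hom s'.hom := by
  refine hom_ext fun i R θ => ?_
  have h1 : ((β_ K' (R ⊗ 𝟙_ E)).hom ≫ (α_ R (𝟙_ E) K').hom) ≫ R ◁ (λ_ K').hom =
      K' ◁ (ρ_ R).hom ≫ (β_ K' R).hom := by simp
  have h2 : K ◁ (β_ K' R).hom ≫ swapLeft K R K' =
      swapLeft K K' R ≫ K' ◁ (β_ K R).hom ≫ (β_ K' (R ⊗ K)).hom ≫ (α_ R K K').hom := by
    rw [swapLeft, swapLeft, BraidedCategory.braiding_naturality_right_assoc]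
    simp only [BraidedCategory.braiding_tensor_right_hom, Category.assoc, Iso.hom_inv_id_assoc]
    rw [← comp_whiskerRight_assoc, SymmetricCategory.symmetry]
    simp
  have h3 : (R ◁ (ρ_ (𝟙_ E)).hom) = (R ◁ (λ_ (𝟙_ E)).hom) := by rw [unitors_equal]
  rw [app_comp, app_comp, s.app_wr, s.app_wr, s'.app_wl, s'.app_wl, h3]
  rw [O.map_map _ _ (s.op _), h1, O.map_map _ _ (s'.op _), swapLeft_unit,
    ← O.map_map (K' ◁ (ρ_ R).hom), s'.natural, ← O.map_map (K ◁ (ρ_ R).hom), s.natural,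
    ← s.natural (β_ K' R).hom, ← s'.natural (β_ K R).hom, O.map_map _ _ θ, O.map_map _ _ θ, h,
    O.map_map _ _ θ, h2]

theorem commute_cup_cap {K K' : E} (s : CupOp O K) (e : CapOp O K')
    (h : ∀ {i : ι} {P : E} (θ : O.obj i (K ⊗ P)),
      e.op (s.op θ) = s.op (O.map (α_ K P K').inv (e.op θ))) :
    Commute s.hom e.hom := by
  refine hom_ext fun i R θ => ?_
  have h1 : R ◁ (λ_ K').hom = (α_ R (𝟙_ E) K').inv ≫ (ρ_ R).hom ▷ K' := by simp
  have h2 : (α_ K (R ⊗ 𝟙_ E) K').inv ≫ (K ◁ (ρ_ R).hom ≫ (β_ K R).hom) ▷ K' =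
      K ◁ ((ρ_ R).hom ▷ K') ≫ (α_ K R K').inv ≫ (β_ K R).hom ▷ K' := by monoidal
  have h3 : R ◁ (λ_ (𝟙_ E)).hom ≫ R ◁ (ρ_ (𝟙_ E)).inv = 𝟙 _ := by
    rw [unitors_equal, ← MonoidalCategory.whiskerLeft_comp]; simp
  have h4 : swapLeft K R K' ≫ (α_ R K K').inv = (α_ K R K').inv ≫ (β_ K R).hom ▷ K' := by
    simp [swapLeft]
  -- Writing `θ` as a restriction along an isomorphism cancels the unitors on both sides.
  obtain ⟨ω, rfl⟩ : ∃ ω, θ = O.map (R ◁ (ρ_ K).hom) ω :=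
    ⟨O.map (R ◁ (ρ_ K).inv) θ, by rw [O.map_map, whiskerLeft_hom_inv, O.map_id]⟩
  rw [app_comp, app_comp, s.app_wr, s.app_wr, e.app_wl, e.app_wl, h1, O.map_map _ _ (s.op _),
    O.map_map _ _ ω, O.map_map _ _ ω, swapLeft_unit, unitors_equal, whiskerLeft_inv_hom,
    whiskerLeft_inv_hom, O.map_id, O.map_id, O.map_map _ _ (e.op ω), h4, ← O.map_map _ _ ω,
    s.natural, e.natural, h, e.natural, O.map_map, O.map_map]

theorem commute_cap_cap {K K' : E} (e : CapOp O K) (e' : CapOp O K')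
    (h : ∀ {i : ι} {P : E} (θ : O.obj i P),
      e'.op (e.op θ) =
        O.map ((α_ P K K').hom ≫ P ◁ (β_ K K').hom ≫ (α_ P K' K).inv) (e.op (e'.op θ))) :
    Commute e.hom e'.hom := by
  refine hom_ext fun i R θ => ?_
  obtain ⟨ω, rfl⟩ : ∃ ω : O.obj i R, θ = O.map (R ◁ (ρ_ (𝟙_ E)).hom ≫ (ρ_ R).hom) ω :=
    ⟨O.map ((ρ_ R).inv ≫ R ◁ (ρ_ (𝟙_ E)).inv) θ, by
      rw [O.map_map, Category.assoc, Iso.hom_inv_id_assoc, whiskerLeft_hom_inv, O.map_id]⟩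
  have h1 : R ◁ (ρ_ K).inv ≫ (R ◁ (β_ K (𝟙_ E)).hom ≫ (α_ R (𝟙_ E) K).inv) ≫ (ρ_ R).hom ▷ K =
      𝟙 _ := by simp
  have h2 : R ◁ (λ_ K').inv ≫ (α_ R (𝟙_ E) K').inv ≫ (ρ_ R).hom ▷ K' = 𝟙 _ := by simp
  rw [app_comp, app_comp, e.app_wr, e.app_wr, e'.app_wl, e'.app_wl, O.map_map _ _ ω,
    O.map_map _ _ ω, unitors_inv_equal, whiskerLeft_inv_hom_assoc, e.natural (ρ_ R).hom,
    e'.natural (ρ_ R).hom, O.map_map _ _ (e.op ω), O.map_map _ _ (e.op ω), h1,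
    O.map_map _ _ (e'.op ω),
    O.map_map _ _ (e'.op ω), h2, O.map_id, O.map_id, h, O.map_map]
  simp

end Cayley

/-! ### Tests -/

namespace Cayley

variable {C : Type u} [Category.{v} C] [MonoidalCategory C] [SymmetricCategory C]

theorem swapLeft_naturality (K R : C) {X X' : C} (f : X ⟶ X') :
    K ◁ R ◁ f ≫ swapLeft K R X' = swapLeft K R X ≫ R ◁ K ◁ f := by
  simp only [swapLeft, Category.assoc]
  rw [associator_inv_naturality_right_assoc, whisker_exchange_assoc, associator_naturality_right]

@[simp]
theorem swapLeft_swapLeft (K R X : C) : swapLeft K R X ≫ swapLeft R K X = 𝟙 _ := by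
  simp only [swapLeft, Category.assoc, Iso.hom_inv_id_assoc]
  rw [← comp_whiskerRight_assoc, SymmetricCategory.symmetry]
  simp

theorem swapLeft_yang_baxter (K R S X : C) :
    swapLeft K R (S ⊗ X) ≫ R ◁ swapLeft K S X ≫ swapLeft R S (K ⊗ X) =
      K ◁ swapLeft R S X ≫ swapLeft K S (R ⊗ X) ≫ S ◁ swapLeft K R X := by
  have h := congrArg (fun f => 𝟙 (K ⊗ (R ⊗ (S ⊗ X))) ⊗≫ f ▷ X ⊗≫ 𝟙 (S ⊗ (R ⊗ (K ⊗ X))))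
    (BraidedCategory.yang_baxter K R S)
  simp only [swapLeft]
  refine Eq.trans ?_ (h.trans ?_) <;> monoidal

end Cayley

section Test

variable {C : Type u} [Category.{v} C] [MonoidalCategory C]

/-- A test of type `(P, N)` with result in `Y`, for the operation `T`: a partial function on the
morphisms `X ⊗ (N ⊗ W) ⟶ P ⊗ W` with values `X ⟶ Y`, for all `X` and all hidden objects `W`. It is
dinatural in `W`, and it takes the same value before and after a part `V` of the hidden object
`W ⊗ V` is traced out by `T`. Naturality in `X` is not needed. -/
structure Test (T : PartialTraceOp C) (Y P N : C) where
  /-- The value of the test; `W` is the hidden object. -/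
  app : ∀ {X W : C}, (X ⊗ (N ⊗ W) ⟶ P ⊗ W) → Part (X ⟶ Y)
  dinat : ∀ {X W W' : C} (c : X ⊗ (N ⊗ W') ⟶ P ⊗ W) (w : W ⟶ W'),
    app (c ≫ P ◁ w) = app (X ◁ N ◁ w ≫ c)
  trace : ∀ {X W V : C} (h : (X ⊗ (N ⊗ W)) ⊗ V ⟶ (P ⊗ W) ⊗ V) (k : X ⊗ (N ⊗ W) ⟶ P ⊗ W),
    k ∈ T V h → app (X ◁ (α_ N W V).inv ≫ (α_ X (N ⊗ W) V).inv ≫ h ≫ (α_ P W V).hom) = app k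

namespace Test

variable {T : PartialTraceOp C} {Y : C}

theorem ext {P N : C} {θ θ' : Test T Y P N}
    (h : ∀ {X W : C} (c : X ⊗ (N ⊗ W) ⟶ P ⊗ W), θ.app c = θ'.app c) : θ = θ' := by
  obtain ⟨a, _, _⟩ := θ
  obtain ⟨a', _, _⟩ := θ'
  have : @a = @a' := by funext X W c; exact h c
  subst this
  rfl

/-- The value of a test does not change when the hidden object is replaced by an isomorphic one. -/
theorem app_iso {P N : C} (θ : Test T Y P N) {X W W' : C} (e : W ≅ W')
    (c : X ⊗ (N ⊗ W') ⟶ P ⊗ W') :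
    θ.app c = θ.app (X ◁ N ◁ e.hom ≫ c ≫ P ◁ e.inv) := by
  rw [← θ.dinat]
  simp

variable [SymmetricCategory C] (hT : IsPartialTrace T)

/-- Restriction of a test along `p : P ⟶ P'` and `n : N' ⟶ N`, which form a morphism
`(P, N) ⟶ (P', N')` of `C × Cᵒᵖ`. -/
def map {P P' N N' : C} (p : P ⟶ P') (n : N' ⟶ N) (θ : Test T Y P' N') : Test T Y P N where
  app {X W} c := θ.app (X ◁ n ▷ W ≫ c ≫ p ▷ W)
  dinat {X W W'} c w := by
    have := θ.dinat (X ◁ n ▷ W' ≫ c ≫ p ▷ W) w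
    simp only [Category.assoc] at this ⊢
    rw [whisker_exchange, this, ← MonoidalCategory.whiskerLeft_comp_assoc, whisker_exchange,
      MonoidalCategory.whiskerLeft_comp_assoc]
  trace {X W V} h k hk := by
    rw [← θ.trace _ _ (hT.naturality h (X ◁ n ▷ W) (p ▷ W) k hk)]
    congr 1
    monoidal

/-- The cap: the object `Z`, which occurs in the positive and in the negative part of the type,
joins the hidden object. -/
def cap (Z : C) {P N : C} (θ : Test T Y P N) : Test T Y (P ⊗ Z) (N ⊗ Z) where
  app {X W} c := θ.app (X ◁ (α_ N Z W).inv ≫ c ≫ (α_ P Z W).hom)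
  dinat {X W W'} c w := by
    have := θ.dinat (X ◁ (α_ N Z W').inv ≫ c ≫ (α_ P Z W).hom) (Z ◁ w)
    simp only [Category.assoc] at this ⊢
    rw [associator_naturality_right, this, ← MonoidalCategory.whiskerLeft_comp_assoc,
      associator_inv_naturality_right, MonoidalCategory.whiskerLeft_comp_assoc]
  trace {X W V} h k hk := by
    rw [← θ.trace _ _ (hT.naturality h (X ◁ (α_ N Z W).inv) (α_ P Z W).hom k hk)]
    rw [θ.app_iso (α_ Z W V)]
    congr 1
    monoidal

/-- The cup: an identity strand on `Z` is put in parallel with the argument. -/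
def cup (Z : C) {P N : C} (θ : Test T Y (Z ⊗ P) (Z ⊗ N)) : Test T Y P N where
  app {X W} c := θ.app (X ◁ (α_ Z N W).hom ≫ Cayley.swapLeft X Z (N ⊗ W) ≫ Z ◁ c ≫ (α_ Z P W).inv)
  dinat {X W W'} c w := by
    have := θ.dinat (X ◁ (α_ Z N W').hom ≫ Cayley.swapLeft X Z (N ⊗ W') ≫ Z ◁ c ≫ (α_ Z P W).inv) w
    simp only [Category.assoc, MonoidalCategory.whiskerLeft_comp] at this ⊢
    rw [associator_inv_naturality_right, this, ← reassoc_of% Cayley.swapLeft_naturality]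
    congr 1
    monoidal
  trace {X W V} h k hk := by
    have := hT.naturality _ (X ◁ (α_ Z N W).hom ≫ Cayley.swapLeft X Z (N ⊗ W)) (α_ Z P W).inv _
      (hT.superposing h (𝟙 Z) k hk)
    simp only [id_tensorHom, Category.assoc] at this
    rw [← θ.trace _ _ this]
    congr 1
    simp only [Cayley.swapLeft]
    monoidal

/-- The unit test, which traces out the hidden object. That it is a test is dinaturality together
with the axiom `vanishing_tensor`. -/
def unit (Y : C) : Test T Y Y (𝟙_ C) where
  app {X W} c := T W (X ◁ (λ_ W).inv ≫ c)
  dinat {X W W'} c w := by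
    rw [← Category.assoc, hT.dinaturality]
    congr 1
    monoidal
  trace {X W V} h k hk := by
    have := hT.naturality h (X ◁ (λ_ W).inv) (𝟙 _) k hk
    rw [id_whiskerRight, Category.comp_id, Category.comp_id] at this
    rw [← hT.vanishing_tensor ((α_ X W V).inv ≫ ((X ◁ (λ_ W).inv) ▷ V ≫ h) ≫ (α_ Y W V).hom) _
      (by simpa using this)]
    congr 1
    monoidal

theorem map_id {P N : C} (θ : Test T Y P N) : map hT (𝟙 P) (𝟙 N) θ = θ := by
  refine ext fun c => ?_
  simp [map]

theorem map_map {P P' P'' N N' N'' : C} (p : P ⟶ P') (n : N' ⟶ N) (p' : P' ⟶ P'') (n' : N'' ⟶ N')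
    (θ : Test T Y P'' N'') : map hT p n (map hT p' n' θ) = map hT (p ≫ p') (n' ≫ n) θ := by
  refine ext fun c => ?_
  simp [map]

theorem cap_map (Z : C) {P P' N N' : C} (p : P ⟶ P') (n : N' ⟶ N) (θ : Test T Y P' N') :
    cap hT Z (map hT p n θ) = map hT (p ▷ Z) (n ▷ Z) (cap hT Z θ) := by
  refine ext fun c => ?_
  simp only [map, cap]
  congr 1
  monoidal

theorem cup_map (Z : C) {P P' N N' : C} (p : P ⟶ P') (n : N' ⟶ N)
    (θ : Test T Y (Z ⊗ P') (Z ⊗ N')) :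
    cup hT Z (map hT (Z ◁ p) (Z ◁ n) θ) = map hT p n (cup hT Z θ) := by
  refine ext fun c => ?_
  simp only [map, cup, MonoidalCategory.whiskerLeft_comp, Category.assoc]
  rw [← reassoc_of% Cayley.swapLeft_naturality]
  congr 1
  monoidal

theorem cap_cup (V Z : C) {P N : C} (θ : Test T Y (Z ⊗ P) (Z ⊗ N)) :
    cap hT V (cup hT Z θ) = cup hT Z (map hT (α_ Z P V).inv (α_ Z N V).hom (cap hT V θ)) := by
  refine ext fun c => ?_
  simp only [map, cup, cap, Cayley.swapLeft]
  congr 1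
  monoidal

/-- Two cups commute, by the Yang-Baxter equation for their strands and the source of the
argument. -/
theorem cup_cup (V Z : C) {P N : C} (θ : Test T Y (V ⊗ (Z ⊗ P)) (V ⊗ (Z ⊗ N))) :
    cup hT Z (cup hT V θ) =
      cup hT V (cup hT Z (map hT (Cayley.swapLeft Z V P) (Cayley.swapLeft V Z N) θ)) := by
  refine ext fun {X W} c => ?_
  simp only [map, cup]
  congr 1
  have h1 : Z ◁ (α_ V P W).inv ≫ (α_ Z (V ⊗ P) W).inv ≫ Cayley.swapLeft Z V P ▷ W =
      Cayley.swapLeft Z V (P ⊗ W) ≫ V ◁ (α_ Z P W).inv ≫ (α_ V (Z ⊗ P) W).inv := by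
    simp only [Cayley.swapLeft]; monoidal
  have h2 : Cayley.swapLeft V Z N ▷ W ≫ (α_ Z (V ⊗ N) W).hom ≫ Z ◁ (α_ V N W).hom =
      (α_ V (Z ⊗ N) W).hom ≫ V ◁ (α_ Z N W).hom ≫ Cayley.swapLeft V Z (N ⊗ W) := by
    simp only [Cayley.swapLeft]; monoidal
  have h3 := Cayley.swapLeft_yang_baxter X Z V (N ⊗ W)
  symm
  calc
    _ = X ◁ (Cayley.swapLeft V Z N ▷ W ≫ (α_ Z (V ⊗ N) W).hom ≫ Z ◁ (α_ V N W).hom) ≫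
          Cayley.swapLeft X Z (V ⊗ (N ⊗ W)) ≫ Z ◁ Cayley.swapLeft X V (N ⊗ W) ≫ Z ◁ V ◁ c ≫
          Z ◁ (α_ V P W).inv ≫ (α_ Z (V ⊗ P) W).inv ≫ Cayley.swapLeft Z V P ▷ W := by
      simp only [MonoidalCategory.whiskerLeft_comp, Category.assoc]
      rw [reassoc_of% Cayley.swapLeft_naturality]
    _ = X ◁ ((α_ V (Z ⊗ N) W).hom ≫ V ◁ (α_ Z N W).hom ≫ Cayley.swapLeft V Z (N ⊗ W)) ≫
          (Cayley.swapLeft X Z (V ⊗ (N ⊗ W)) ≫ Z ◁ Cayley.swapLeft X V (N ⊗ W) ≫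
          Cayley.swapLeft Z V (X ⊗ (N ⊗ W))) ≫ V ◁ Z ◁ c ≫ V ◁ (α_ Z P W).inv ≫
          (α_ V (Z ⊗ P) W).inv := by
      rw [h1, h2, reassoc_of% Cayley.swapLeft_naturality]
      simp only [Category.assoc]
    _ = X ◁ (α_ V (Z ⊗ N) W).hom ≫ X ◁ V ◁ (α_ Z N W).hom ≫
          Cayley.swapLeft X V (Z ⊗ (N ⊗ W)) ≫ V ◁ Cayley.swapLeft X Z (N ⊗ W) ≫ V ◁ Z ◁ c ≫
          V ◁ (α_ Z P W).inv ≫ (α_ V (Z ⊗ P) W).inv := by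
      rw [h3]
      simp only [MonoidalCategory.whiskerLeft_comp, Category.assoc]
      rw [← MonoidalCategory.whiskerLeft_comp_assoc X (Cayley.swapLeft V Z _),
        Cayley.swapLeft_swapLeft, MonoidalCategory.whiskerLeft_id, Category.id_comp]
    _ = _ := by
      rw [reassoc_of% Cayley.swapLeft_naturality]
      simp only [MonoidalCategory.whiskerLeft_comp, Category.assoc]

/-- Two caps commute, by dinaturality in the exchange of the two hidden objects. -/
theorem cap_cap (V Z : C) {P N : C} (θ : Test T Y P N) :
    cap hT V (cap hT Z θ) =
      map hT ((α_ P Z V).hom ≫ P ◁ (β_ Z V).hom ≫ (α_ P V Z).inv)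
        ((α_ N V Z).hom ≫ N ◁ (β_ V Z).hom ≫ (α_ N Z V).inv) (cap hT Z (cap hT V θ)) := by
  refine ext fun {X W} c => ?_
  rw [cap, cap, Test.app_iso _ (⟨Cayley.swapLeft V Z W, Cayley.swapLeft Z V W, by simp, by simp⟩ :
    V ⊗ (Z ⊗ W) ≅ Z ⊗ (V ⊗ W))]
  simp only [map, cap, Cayley.swapLeft]
  congr 1
  monoidal

end Test
end Test

/-! ### Loops seen by tests -/

section Test

variable {C : Type u} [Category.{v} C] [MonoidalCategory C] [SymmetricCategory C]
  {T : PartialTraceOp C} {Y : C}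

/-- The exchange of the last two factors of `(Q ⊗ Z) ⊗ W`. -/
def swapRight (Q Z W : C) : (Q ⊗ Z) ⊗ W ⟶ (Q ⊗ W) ⊗ Z :=
  (α_ Q Z W).hom ≫ Q ◁ (β_ Z W).hom ≫ (α_ Q W Z).inv

@[simp]
theorem swapRight_swapRight (Q Z W : C) : swapRight Q Z W ≫ swapRight Q W Z = 𝟙 _ := by
  simp only [swapRight, Category.assoc, Iso.inv_hom_id_assoc]
  rw [← MonoidalCategory.whiskerLeft_comp_assoc, SymmetricCategory.symmetry]
  simp

/-- Yanking a strand `Z` in the presence of spectators. -/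
theorem id_mem_swapRight (hT : IsPartialTrace T) (Q Z : C) : 𝟙 (Q ⊗ Z) ∈ T Z (swapRight Q Z Z) := by
  have h : 𝟙 Z ∈ T Z (β_ Z Z).hom := by rw [hT.yanking]; exact Part.mem_some _
  simpa [swapRight] using hT.superposing _ (𝟙 Q) _ h

/-- Superposing on the right. -/
theorem whiskerRight_mem (hT : IsPartialTrace T) {X Y U : C} {f : X ⊗ U ⟶ Y ⊗ U} {k : X ⟶ Y}
    (hk : k ∈ T U f) (W : C) : k ▷ W ∈ T U (swapRight X W U ≫ f ▷ W ≫ swapRight Y U W) := by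
  have h := hT.naturality _ (β_ X W).hom (β_ W Y).hom _ (hT.superposing f (𝟙 W) k hk)
  rw [id_tensorHom, id_tensorHom, BraidedCategory.braiding_naturality_right,
    SymmetricCategory.symmetry_assoc] at h
  convert h using 2
  have h1 : (β_ X W).hom ▷ U ≫ (α_ W X U).hom = swapRight X W U ≫ (β_ (X ⊗ U) W).hom := by
    simp only [swapRight, BraidedCategory.braiding_tensor_left_hom, Category.assoc,
      Iso.inv_hom_id_assoc]
    rw [← MonoidalCategory.whiskerLeft_comp_assoc, SymmetricCategory.symmetry]
    simp
  have h2 : (α_ W Y U).inv ≫ (β_ W Y).hom ▷ U = (β_ W (Y ⊗ U)).hom ≫ swapRight Y U W := by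
    simp only [swapRight, BraidedCategory.braiding_tensor_right_hom, Category.assoc,
      Iso.inv_hom_id_assoc]
    rw [← MonoidalCategory.whiskerLeft_comp_assoc, SymmetricCategory.symmetry]
    simp
  simp only [Category.assoc]
  rw [h2, reassoc_of% h1, BraidedCategory.braiding_naturality_right_assoc,
    SymmetricCategory.symmetry_assoc]

theorem whiskerLeft_mem (hT : IsPartialTrace T) {X Y U : C} {f : X ⊗ U ⟶ Y ⊗ U} {k : X ⟶ Y}
    (hk : k ∈ T U f) (W : C) : W ◁ k ∈ T U ((α_ W X U).hom ≫ W ◁ f ≫ (α_ W Y U).inv) := by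
  simpa using hT.superposing f (𝟙 W) k hk

theorem swapRight_braid (Q Z Z' W : C) :
    swapRight Q Z W ▷ Z' ≫ swapRight (Q ⊗ W) Z Z' ≫ swapRight Q W Z' ▷ Z =
      swapRight (Q ⊗ Z) W Z' ≫ swapRight Q Z Z' ▷ W ≫ swapRight (Q ⊗ Z') Z W := by
  have h := congrArg (fun f => 𝟙 (((Q ⊗ Z) ⊗ W) ⊗ Z') ⊗≫ Q ◁ f ⊗≫ 𝟙 (((Q ⊗ Z') ⊗ W) ⊗ Z))
    (BraidedCategory.yang_baxter Z W Z')
  simp only [swapRight]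
  refine Eq.trans ?_ (h.trans ?_) <;> monoidal

theorem swapLeft_braiding (X N Z W : C) :
    X ◁ ((α_ N Z W).inv ≫ (β_ N Z).hom ▷ W ≫ (α_ Z N W).hom) ≫ Cayley.swapLeft X Z (N ⊗ W) =
      X ◁ N ◁ (β_ Z W).hom ≫ X ◁ (α_ N W Z).inv ≫ (α_ X (N ⊗ W) Z).inv ≫
        (β_ (X ⊗ (N ⊗ W)) Z).hom := by
  simp only [BraidedCategory.braiding_tensor_left_hom, Cayley.swapLeft, Iso.inv_hom_id_assoc,
    MonoidalCategory.whiskerLeft_comp, Category.assoc, whiskerLeft_inv_hom_assoc]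
  rw [← MonoidalCategory.whiskerLeft_comp_assoc X (N ◁ _), ← MonoidalCategory.whiskerLeft_comp,
    SymmetricCategory.symmetry]
  simp

theorem braiding_swapRight (P Z W : C) :
    (β_ (P ⊗ W) Z).hom ≫ (α_ Z P W).inv ≫ (β_ Z P).hom ▷ W = swapRight P W Z := by
  simp only [BraidedCategory.braiding_tensor_left_hom, Category.assoc, Iso.hom_inv_id_assoc,
    swapRight]
  rw [← comp_whiskerRight, SymmetricCategory.symmetry]
  simp

namespace Test

/-- A cup followed by `p : P ⊗ U ⟶ Q ⊗ U` and a cap evaluates a test at the composite of the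
argument with `p`, the object `U` being hidden. -/
theorem cup_map_cap_app (hT : IsPartialTrace T) {P Q N U : C} (p : P ⊗ U ⟶ Q ⊗ U)
    (θ : Test T Y Q N) {X W : C} (c : X ⊗ (N ⊗ W) ⟶ P ⊗ W) :
    (cup hT U (map hT ((β_ U P).hom ≫ p) (β_ N U).hom (cap hT U θ))).app c =
      θ.app (X ◁ N ◁ (β_ U W).hom ≫ X ◁ (α_ N W U).inv ≫ (α_ X (N ⊗ W) U).inv ≫ c ▷ U ≫
        swapRight P W U ≫ p ▷ W ≫ (α_ Q U W).hom) := by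
  simp only [map, cup, cap]
  congr 1
  have h5 : (β_ _ U).hom ≫ U ◁ c = c ▷ U ≫ (β_ (P ⊗ W) U).hom :=
    (BraidedCategory.braiding_naturality_left c U).symm
  have h1 := swapLeft_braiding X N U W
  simp only [MonoidalCategory.whiskerLeft_comp, Category.assoc] at h1
  have h6 := braiding_swapRight P U W
  simp only [comp_whiskerRight, Category.assoc]
  rw [reassoc_of% h1, reassoc_of% h5, reassoc_of% h6]

/-- If the trace of `p` is defined, then a cup followed by `p` and a cap acts on tests like this
trace, since tests take the same value before and after tracing. -/
theorem cup_map_cap_of_mem (hT : IsPartialTrace T) {P Q N U : C} {p : P ⊗ U ⟶ Q ⊗ U} {q : P ⟶ Q}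
    (hq : q ∈ T U p) (θ : Test T Y Q N) :
    cup hT U (map hT ((β_ U P).hom ≫ p) (β_ N U).hom (cap hT U θ)) = map hT q (𝟙 N) θ := by
  refine ext fun {X W} c => ?_
  rw [cup_map_cap_app]
  -- The argument of the test on the right is itself a trace over `U`.
  have hk := hT.naturality _ c (𝟙 _) _ (whiskerRight_mem hT hq W)
  rw [id_whiskerRight, Category.comp_id, Category.comp_id] at hk
  simp only [map, id_whiskerRight, MonoidalCategory.whiskerLeft_id, Category.id_comp]
  rw [← θ.trace _ _ hk, θ.app_iso (β_ U W)]
  congr 1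
  have h3 : (β_ U W).inv = (β_ W U).hom :=
    (SymmetricCategory.braiding_swap_eq_inv_braiding U W).symm
  have h4 : swapRight Q U W ≫ (α_ Q W U).hom ≫ Q ◁ (β_ W U).hom = (α_ Q U W).hom := by
    rw [← cancel_mono (α_ Q U W).inv, Category.assoc, Category.assoc, Iso.hom_inv_id]
    exact swapRight_swapRight _ _ _
  simp only [Category.assoc]
  rw [h3, h4]

/-- A cup and a cap whose strand `Z` passes through the negative part of the type can be
straightened: the loop arises on the source side of the argument and is removed by yanking. -/
theorem cup_cap_neg (hT : IsPartialTrace T) {Q P Z : C} (θ : Test T Y P (Q ⊗ Z)) :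
    cup hT Z (map hT (β_ Z P).hom (swapRight Q Z Z ≫ (β_ (Q ⊗ Z) Z).hom) (cap hT Z θ)) = θ := by
  refine ext fun {X W} c => ?_
  -- By yanking, `c` is the trace of a loop on `Z` that is formed before `c`.
  have hk := hT.naturality _ (X ◁ swapRight Q Z W ≫ (α_ X (Q ⊗ W) Z).inv)
    ((α_ X (Q ⊗ W) Z).hom ≫ X ◁ swapRight Q W Z ≫ c) _ (id_mem_swapRight hT (X ⊗ (Q ⊗ W)) Z)
  rw [Category.id_comp, Category.assoc, Iso.inv_hom_id_assoc,
    ← MonoidalCategory.whiskerLeft_comp_assoc, swapRight_swapRight,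
    MonoidalCategory.whiskerLeft_id, Category.id_comp] at hk
  rw [← θ.trace _ _ hk, θ.app_iso (β_ Z W)]
  simp only [map, cup, cap]
  congr 1
  have h3 : (β_ Z W).inv = (β_ W Z).hom :=
    (SymmetricCategory.braiding_swap_eq_inv_braiding Z W).symm
  have h5 : (β_ _ Z).hom ≫ Z ◁ c = c ▷ Z ≫ (β_ (P ⊗ W) Z).hom :=
    (BraidedCategory.braiding_naturality_left c Z).symm
  have h6 : (β_ (P ⊗ W) Z).hom ≫ (α_ Z P W).inv ≫ (β_ Z P).hom ▷ W ≫ (α_ P Z W).hom =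
      (α_ P W Z).hom ≫ P ◁ (β_ W Z).hom := by
    simp only [BraidedCategory.braiding_tensor_left_hom, Category.assoc, Iso.hom_inv_id_assoc]
    rw [← comp_whiskerRight_assoc, SymmetricCategory.symmetry]
    simp
  have h1 := swapLeft_braiding X (Q ⊗ Z) Z W
  have h8 : (α_ X (Q ⊗ W) Z).inv ▷ Z ≫ swapRight (X ⊗ (Q ⊗ W)) Z Z ≫ (α_ X (Q ⊗ W) Z).hom ▷ Z =
      (α_ X ((Q ⊗ W) ⊗ Z) Z).hom ≫ X ◁ swapRight (Q ⊗ W) Z Z ≫ (α_ X ((Q ⊗ W) ⊗ Z) Z).inv := by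
    simp only [swapRight]
    monoidal
  have h9 : (X ◁ swapRight Q Z W) ▷ Z ≫ ((α_ X (Q ⊗ W) Z).inv ▷ Z ≫
      swapRight (X ⊗ (Q ⊗ W)) Z Z ≫ (α_ X (Q ⊗ W) Z).hom ▷ Z) ≫ (X ◁ swapRight Q W Z) ▷ Z =
      (α_ _ _ _).hom ≫ X ◁ (swapRight (Q ⊗ Z) W Z ≫ swapRight Q Z Z ▷ W ≫
        swapRight (Q ⊗ Z) Z W) ≫ (α_ _ _ _).inv := by
    rw [h8, ← swapRight_braid]
    monoidal
  have h10 : (α_ (Q ⊗ Z) Z W).hom ≫ (Q ⊗ Z) ◁ (β_ Z W).hom ≫ (α_ (Q ⊗ Z) W Z).inv =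
    swapRight (Q ⊗ Z) Z W := rfl
  have h11 : (Q ⊗ Z) ◁ (β_ Z W).hom ≫ (α_ (Q ⊗ Z) W Z).inv ≫ swapRight (Q ⊗ Z) W Z =
      (α_ (Q ⊗ Z) Z W).inv := by
    rw [← cancel_epi (α_ (Q ⊗ Z) Z W).hom, Iso.hom_inv_id, reassoc_of% h10, swapRight_swapRight]
  symm
  calc
    _ = X ◁ ((Q ⊗ Z) ◁ (β_ Z W).hom ≫ (α_ (Q ⊗ Z) W Z).inv ≫ swapRight (Q ⊗ Z) W Z ≫
          swapRight Q Z Z ▷ W ≫ swapRight (Q ⊗ Z) Z W) ≫ (α_ _ _ _).inv ≫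
          c ▷ Z ≫ (α_ P W Z).hom ≫ P ◁ (β_ W Z).hom := by
      rw [h3]
      simp only [comp_whiskerRight, Category.assoc] at h9 ⊢
      rw [reassoc_of% h9]
      simp only [MonoidalCategory.whiskerLeft_comp, Category.assoc, Iso.inv_hom_id_assoc]
    _ = X ◁ (α_ (Q ⊗ Z) Z W).inv ≫ X ◁ swapRight Q Z Z ▷ W ≫ X ◁ (α_ (Q ⊗ Z) Z W).hom ≫
          (X ◁ (Q ⊗ Z) ◁ (β_ Z W).hom ≫ X ◁ (α_ (Q ⊗ Z) W Z).inv ≫ (α_ _ _ _).inv ≫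
            (β_ (X ⊗ ((Q ⊗ Z) ⊗ W)) Z).hom) ≫ Z ◁ c ≫ (α_ Z P W).inv ≫ (β_ Z P).hom ▷ W ≫
              (α_ P Z W).hom := by
      rw [reassoc_of% h11, ← h10]
      simp only [MonoidalCategory.whiskerLeft_comp, Category.assoc]
      rw [reassoc_of% h5, h6]
    _ = _ := by
      rw [← h1]
      simp only [MonoidalCategory.whiskerLeft_comp, Category.assoc, comp_whiskerRight,
        whiskerLeft_hom_inv_assoc]

/-- The unit test, with a trivial spectator. -/
def base (hT : IsPartialTrace T) (Y : C) : Test T Y (𝟙_ C ⊗ Y) (𝟙_ C ⊗ 𝟙_ C) :=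
  map hT (λ_ Y).hom (λ_ (𝟙_ C)).inv (unit hT Y)

/-- The structural morphism at which tests with a trivial spectator are evaluated; the hidden object
is the unit. -/
def baseContext (X : C) : X ⊗ ((𝟙_ C ⊗ 𝟙_ C) ⊗ 𝟙_ C) ⟶ (𝟙_ C ⊗ X) ⊗ 𝟙_ C :=
  X ◁ ((ρ_ _).hom ≫ (λ_ _).hom) ≫ (ρ_ X).hom ≫ (λ_ X).inv ≫ (ρ_ _).inv

theorem map_base_app (hT : IsPartialTrace T) {X Y : C} (f : X ⟶ Y) :
    (map hT (𝟙_ C ◁ f) (𝟙 _) (base hT Y)).app (baseContext X) = Part.some f := by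
  simp only [map, base, unit, hT.vanishing_unit]
  congr 1
  simp [baseContext]

theorem cup_map_cap_base_app (hT : IsPartialTrace T) {X Y U : C} (f : X ⊗ U ⟶ Y ⊗ U) :
    (cup hT U (map hT ((β_ U (𝟙_ C ⊗ X)).hom ≫ (α_ _ X U).hom ≫ 𝟙_ C ◁ f ≫ (α_ _ Y U).inv)
      (β_ (𝟙_ C ⊗ 𝟙_ C) U).hom (cap hT U (base hT Y)))).app (baseContext X) = T U f := by
  rw [cup_map_cap_app]
  -- The hidden object is `U ⊗ 𝟙`, which dinaturality replaces by `U`.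
  have h := hT.dinaturality (X ◁ (ρ_ U).hom ≫ f) (ρ_ U).inv
  rw [whiskerLeft_inv_hom_assoc] at h
  rw [← h]
  simp only [map, base, unit]
  congr 1
  simp [baseContext, swapRight]
  monoidal

end Test
end Test

/-! ### The category `C × Cᵒᵖ` and its presheaves of tests -/

section Product

variable {C : Type u} [Category.{v} C] [MonoidalCategory C] [SymmetricCategory C]

instance opSymmetricCategory : SymmetricCategory Cᵒᵖ where
  symmetry X Y := Quiver.Hom.unop_inj (SymmetricCategory.symmetry X.unop Y.unop)

variable {D : Type u₁} [Category.{v₁} D] [MonoidalCategory D] [SymmetricCategory D]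

instance prodSymmetricCategory : SymmetricCategory (C × D) where
  braiding X Y := (β_ X.1 Y.1).prod (β_ X.2 Y.2)
  braiding_naturality_right X Y Z f := by ext <;> simp
  braiding_naturality_left f Z := by ext <;> simp
  hexagon_forward X Y Z := by ext <;> simp
  hexagon_reverse X Y Z := by ext <;> simp
  symmetry X Y := by ext <;> simp

end Product

section TestPresheaf

variable {C : Type u} [Category.{v} C] [MonoidalCategory C] [SymmetricCategory C]
  {T : PartialTraceOp C}

/-- The presheaves of tests on `C × Cᵒᵖ`, indexed by the objects of `C`. -/
def testPresheaf (hT : IsPartialTrace T) :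
    PresheafFamily.{u, v, max u v, u} (C × Cᵒᵖ) C where
  obj Y P := Test T Y P.1 P.2.unop
  map e θ := Test.map hT e.1 e.2.unop θ
  map_id θ := Test.map_id hT θ
  map_map _ _ θ := Test.map_map hT _ _ _ _ θ

theorem testPresheaf_map (hT : IsPartialTrace T) {A B : C × Cᵒᵖ} (e : A ⟶ B) {Y : C}
    (θ : (testPresheaf hT).obj Y B) :
    (testPresheaf hT).map e θ = Test.map hT e.1 e.2.unop θ := rfl

/-- The object `(Z, Z)`, which stands for the tensor product of `Z` with its formal dual. -/
abbrev delta (Z : C) : C × Cᵒᵖ := (Z, Opposite.op Z)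

/-- The cup on `Z`, as an operation on tests. -/
def testCup (hT : IsPartialTrace T) (Z : C) : Cayley.CupOp (testPresheaf hT) (delta Z) where
  op θ := Test.cup hT Z θ
  natural _ θ := Test.cup_map hT Z _ _ θ

/-- The cap on `Z`, as an operation on tests. -/
def testCap (hT : IsPartialTrace T) (Z : C) : Cayley.CapOp (testPresheaf hT) (delta Z) where
  op θ := Test.cap hT Z θ
  natural _ θ := Test.cap_map hT Z _ _ θ

theorem swapLeft_op_unop (A B X : C × Cᵒᵖ) : (Cayley.swapLeft A B X).2.unop =
    Cayley.swapLeft B.2.unop A.2.unop X.2.unop := Category.assoc _ _ _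

/-- The class of all cups and caps. -/
inductive IsCupOrCap (hT : IsPartialTrace T) : ∀ ⦃A B : C × Cᵒᵖ⦄,
    ((Cayley.lift (testPresheaf hT)).obj A ⟶ (Cayley.lift (testPresheaf hT)).obj B) → Prop
  | cup (Z : C) : IsCupOrCap hT (testCup hT Z).hom
  | cap (Z : C) : IsCupOrCap hT (testCap hT Z).hom

theorem commute_testCup_testCap (hT : IsPartialTrace T) (Z V : C) :
    Cayley.Commute (testCup hT Z).hom (testCap hT V).hom :=
  Cayley.commute_cup_cap _ _ fun θ => Test.cap_cup hT V Z θ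

/-- All cups and caps, as a commuting class. -/
def cupCapClass (hT : IsPartialTrace T) : CommutingClass (testPresheaf hT) where
  mem := IsCupOrCap hT
  commute φ ψ hφ hψ := by
    obtain ⟨Z⟩ | ⟨Z⟩ := hφ <;> obtain ⟨V⟩ | ⟨V⟩ := hψ
    · refine Cayley.commute_cup_cup _ _ fun {Y P} θ => ?_
      rw [testPresheaf_map, swapLeft_op_unop]
      exact Test.cup_cup hT V Z θ
    · exact commute_testCup_testCap hT Z V
    · exact (commute_testCup_testCap hT V Z).symm
    · refine Cayley.commute_cap_cap _ _ fun {Y P} θ => ?_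
      refine (Test.cap_cap hT V Z θ).trans ?_
      congr 1
      exact (Category.assoc _ _ _).symm

end TestPresheaf

/-! ### Closing a strand by a cup and a cap -/

namespace Cayley

variable {E : Type u} [Category.{v} E] [MonoidalCategory E] [SymmetricCategory E] {ι : Type w'}
  {O : PresheafFamily.{u, v, w, w'} E ι} {K : E}

/-- The morphism `m` with its strand `K` closed by a cup and a cap. -/
def loop (s : CupOp O K) (e : CapOp O K) {X Y : E} (m : X ⊗ K ⟶ Y ⊗ K) :
    (lift O).obj X ⟶ (lift O).obj Y :=
  (lift O).map (ρ_ X).inv ≫ wl X s.hom ≫ (lift O).map m ≫ wl Y e.hom ≫ (lift O).map (ρ_ Y).hom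

theorem app_loop (s : CupOp O K) (e : CapOp O K) {X Y : E} (m : X ⊗ K ⟶ Y ⊗ K) {i : ι} (R : E)
    (θ : O.obj i (R ⊗ Y)) :
    app (loop s e m) R θ =
      s.op (O.map ((β_ K (R ⊗ X)).hom ≫ (α_ R X K).hom ≫ R ◁ m ≫ (α_ R Y K).inv) (e.op θ)) := by
  rw [loop, app_comp, app_comp, app_comp, app_comp, app_lift, app_lift, app_lift, s.app_wl,
    e.app_wl, O.map_map _ _ θ, whiskerLeft_inv_hom, O.map_id, O.map_map, O.map_map, O.map_map,
    whiskerLeft_inv_hom, O.map_id]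
  simp only [Category.assoc]

/-- A triangle identity for the pairing `s ≫ a`, `b ≫ e` of `P` and `N`, reduced to a loop. -/
theorem loop_triangle_right (s : CupOp O K) (e : CapOp O K) {P N : E} (a : K ⟶ P ⊗ N)
    (b : N ⊗ P ⟶ K)
    (h : loop s e ((β_ P K).hom ≫ a ▷ P ≫ (α_ P N P).hom ≫ P ◁ b) = 𝟙 _) :
    wr (s.hom ≫ (lift O).map a) P ≫ (lift O).map (α_ P N P).hom ≫
      wl P ((lift O).map b ≫ e.hom) = (lift O).map (λ_ P).hom ≫ (lift O).map (ρ_ P).inv := by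
  rw [← cancel_mono ((lift O).map (ρ_ P).hom),
    ← cancel_epi ((lift O).map (λ_ P).inv)]
  simp only [Category.assoc, ← Functor.map_comp, Iso.inv_hom_id, Category.comp_id,
    CategoryTheory.Functor.map_id]
  rw [← h, loop, wr_comp, wl_comp, wr, wr_lift, wl_lift]
  simp only [Category.assoc, Functor.map_comp]
  rw [← Functor.map_comp_assoc, leftUnitor_inv_braiding]

/-- The other triangle identity for the pairing `s ≫ a`, `b ≫ e` of `P` and `N`, reduced to a
loop. -/
theorem loop_triangle_left (s : CupOp O K) (e : CapOp O K) {P N : E} (a : K ⟶ P ⊗ N)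
    (b : N ⊗ P ⟶ K)
    (h : loop s e (N ◁ a ≫ (α_ N P N).inv ≫ b ▷ N ≫ (β_ K N).hom) = 𝟙 _) :
    wl N (s.hom ≫ (lift O).map a) ≫ (lift O).map (α_ N P N).inv ≫
      wr ((lift O).map b ≫ e.hom) N = (lift O).map (ρ_ N).hom ≫ (lift O).map (λ_ N).inv := by
  rw [← cancel_mono ((lift O).map (λ_ N).hom),
    ← cancel_epi ((lift O).map (ρ_ N).inv)]
  simp only [Category.assoc, ← Functor.map_comp, Iso.inv_hom_id, Category.comp_id,
    CategoryTheory.Functor.map_id]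
  have h1 : wr e.hom N = (lift O).map (β_ K N).hom ≫ wl N e.hom ≫
    (lift O).map (β_ N (𝟙_ E)).hom := rfl
  rw [← h, loop, wr_comp, wl_comp, wr_lift, wl_lift, h1]
  simp only [Category.assoc, Functor.map_comp]
  rw [← Functor.map_comp, braiding_leftUnitor]

end Cayley

section Rigid

open Opposite Cayley

variable {C : Type u} [Category.{v} C] [MonoidalCategory C] [SymmetricCategory C]
  {T : PartialTraceOp C} (hT : IsPartialTrace T)

/-- The object of `C × Cᵒᵖ` that stands for the object `X` of `C`. -/
abbrev pos (X : C) : C × Cᵒᵖ := (X, 𝟙_ Cᵒᵖ)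

/-- The object of `C × Cᵒᵖ` that stands for the formal dual of the object `X` of `C`. -/
abbrev neg (X : C) : C × Cᵒᵖ := (𝟙_ C, op X)

/-- The morphism of `C × Cᵒᵖ` that stands for a morphism of `C`. -/
abbrev posHom {X Y : C} (f : X ⟶ Y) : pos X ⟶ pos Y := Prod.mkHom f (𝟙 _)

/-- A morphism `X ⊗ U ⟶ Y ⊗ U` of `C`, with `U` completed by its formal dual, on which it acts
trivially. -/
abbrev posDeltaHom {X Y U : C} (f : X ⊗ U ⟶ Y ⊗ U) : pos X ⊗ delta U ⟶ pos Y ⊗ delta U :=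
  Prod.mkHom f (𝟙 _)

theorem posDeltaHom_unop {X Y U : C} (f : X ⊗ U ⟶ Y ⊗ U) (R : C × Cᵒᵖ) :
    ((β_ (delta U) (R ⊗ pos X)).hom ≫ (α_ R (pos X) (delta U)).hom ≫
      R ◁ posDeltaHom f ≫ (α_ R (pos Y) (delta U)).inv).2.unop =
      (β_ (R.2.unop ⊗ 𝟙_ C) U).hom := by
  change (((α_ R.2.unop (𝟙_ C) U).hom ≫ R.2.unop ◁ 𝟙 (𝟙_ C ⊗ U)) ≫
    (α_ R.2.unop (𝟙_ C) U).inv) ≫ (β_ (R.2.unop ⊗ 𝟙_ C) U).hom = _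
  rw [MonoidalCategory.whiskerLeft_id, Category.comp_id, Iso.hom_inv_id, Category.id_comp]

/-- The loop around `f` formed by the cup and the cap is the trace of `f`, if this is defined. -/
theorem loop_eq_of_mem {X Y U : C} {f : X ⊗ U ⟶ Y ⊗ U} {g : X ⟶ Y} (hg : g ∈ T U f) :
    loop (testCup hT U) (testCap hT U) (posDeltaHom f) =
      (lift (testPresheaf hT)).map (posHom g) := by
  refine hom_ext fun A R θ => ?_
  rw [app_loop, app_lift, testPresheaf_map, testPresheaf_map, posDeltaHom_unop]
  have h := Test.cup_map_cap_of_mem hT (whiskerLeft_mem hT hg R.1) θ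
  have e1 : (R ◁ posHom g).2.unop = 𝟙 _ := by simp
  rw [e1]
  exact h

/-- `Test.base` as an element of the presheaf of tests. -/
def baseElement (Y : C) : (testPresheaf hT).obj Y (𝟙_ (C × Cᵒᵖ) ⊗ pos Y) := Test.base hT Y

/-- Evaluation at the unit test recovers the trace of `f` from the loop around `f`. -/
theorem mem_of_loop_eq {X Y U : C} {f : X ⊗ U ⟶ Y ⊗ U} {g : X ⟶ Y}
    (h : loop (testCup hT U) (testCap hT U) (posDeltaHom f) =
      (lift (testPresheaf hT)).map (posHom g)) : g ∈ T U f := by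
  have h1 := app_loop (testCup hT U) (testCap hT U) (posDeltaHom f) (i := Y) (𝟙_ (C × Cᵒᵖ))
    (baseElement hT Y)
  rw [h, app_lift, testPresheaf_map, testPresheaf_map, posDeltaHom_unop] at h1
  have h2 := congrArg (fun θ => Test.app θ (Test.baseContext X)) h1.symm
  have e1 : (𝟙_ (C × Cᵒᵖ) ◁ posHom g).2.unop = 𝟙 _ := by simp
  rw [e1] at h2
  have h3 := (Test.cup_map_cap_base_app hT f).symm.trans (h2.trans (Test.map_base_app hT g))
  rw [h3]
  exact Part.mem_some g

theorem lift_posHom_injective {X Y : C} {f g : X ⟶ Y}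
    (h : (lift (testPresheaf hT)).map (posHom f) = (lift (testPresheaf hT)).map (posHom g)) :
    f = g := by
  have e1 : ∀ g : X ⟶ Y, Test.app (Test.map hT (𝟙_ (C × Cᵒᵖ) ◁ posHom g).1
      (𝟙_ (C × Cᵒᵖ) ◁ posHom g).2.unop (baseElement hT Y)) (Test.baseContext X) = Part.some g := by
    intro g
    have e2 : (𝟙_ (C × Cᵒᵖ) ◁ posHom g).2.unop = 𝟙 _ := by simp
    rw [e2]
    exact Test.map_base_app hT g
  have h1 := congrArg (fun φ => Test.app (app φ (i := Y) (𝟙_ (C × Cᵒᵖ)) (baseElement hT Y))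
    (Test.baseContext X)) h
  exact Part.some_injective ((e1 f).symm.trans (h1.trans (e1 g)))

/-! ### The compact closed envelope and the embedding -/

/-- The identification of `(Z, Z)` with `(Z, 𝟙) ⊗ (𝟙, Z)`. -/
def deltaSplit (Z : C) : delta Z ≅ pos Z ⊗ neg Z := Iso.prod (ρ_ Z).symm (λ_ (op Z)).symm

/-- The identification of `(𝟙, Z) ⊗ (Z, 𝟙)` with `(Z, Z)`. -/
def deltaMerge (Z : C) : neg Z ⊗ pos Z ≅ delta Z := Iso.prod (λ_ Z) (ρ_ (op Z))

/-- The loop of one triangle identity is the trace of the symmetry of `Z`, that is, yanking. -/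
theorem loop_right (Z : C) :
    loop (testCup hT Z) (testCap hT Z) ((β_ (pos Z) (delta Z)).hom ≫
      (deltaSplit Z).hom ▷ pos Z ≫ (α_ (pos Z) (neg Z) (pos Z)).hom ≫
        pos Z ◁ (deltaMerge Z).hom) = 𝟙 _ := by
  have h : (β_ (pos Z) (delta Z)).hom ≫ (deltaSplit Z).hom ▷ pos Z ≫
      (α_ (pos Z) (neg Z) (pos Z)).hom ≫ pos Z ◁ (deltaMerge Z).hom =
        posDeltaHom (β_ Z Z).hom := by
    refine Prod.ext ?_ (Quiver.Hom.unop_inj ?_)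
    · change (β_ Z Z).hom ≫ (ρ_ Z).inv ▷ Z ≫ (α_ Z (𝟙_ C) Z).hom ≫ Z ◁ (λ_ Z).hom = (β_ Z Z).hom
      simp
    · change ((𝟙_ C ◁ (ρ_ Z).inv ≫ (α_ (𝟙_ C) Z (𝟙_ C)).inv) ≫ (λ_ Z).hom ▷ 𝟙_ C) ≫
        (β_ Z (𝟙_ C)).hom = 𝟙 _
      simp
  rw [h, loop_eq_of_mem hT (by rw [hT.yanking]; exact Part.mem_some _)]
  exact (lift (testPresheaf hT)).map_id _

theorem loop_left (Z : C) :
    loop (testCup hT Z) (testCap hT Z) (neg Z ◁ (deltaSplit Z).hom ≫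
      (α_ (neg Z) (pos Z) (neg Z)).inv ≫ (deltaMerge Z).hom ▷ neg Z ≫
        (β_ (delta Z) (neg Z)).hom) = 𝟙 _ := by
  refine hom_ext fun Y R θ => ?_
  rw [app_loop, app_id, testPresheaf_map]
  have h1 : ((β_ (delta Z) (R ⊗ neg Z)).hom ≫ (α_ R (neg Z) (delta Z)).hom ≫
      R ◁ (neg Z ◁ (deltaSplit Z).hom ≫ (α_ (neg Z) (pos Z) (neg Z)).inv ≫
        (deltaMerge Z).hom ▷ neg Z ≫ (β_ (delta Z) (neg Z)).hom) ≫
          (α_ R (neg Z) (delta Z)).inv).1 = (β_ Z (R.1 ⊗ 𝟙_ C)).hom := by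
    change (β_ Z (R.1 ⊗ 𝟙_ C)).hom ≫ (α_ R.1 (𝟙_ C) Z).hom ≫ R.1 ◁ (𝟙_ C ◁ (ρ_ Z).inv ≫
      (α_ (𝟙_ C) Z (𝟙_ C)).inv ≫ (λ_ Z).hom ▷ 𝟙_ C ≫ (β_ Z (𝟙_ C)).hom) ≫
        (α_ R.1 (𝟙_ C) Z).inv = _
    simp
  have h2 : ((β_ (delta Z) (R ⊗ neg Z)).hom ≫ (α_ R (neg Z) (delta Z)).hom ≫
      R ◁ (neg Z ◁ (deltaSplit Z).hom ≫ (α_ (neg Z) (pos Z) (neg Z)).inv ≫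
        (deltaMerge Z).hom ▷ neg Z ≫ (β_ (delta Z) (neg Z)).hom) ≫
          (α_ R (neg Z) (delta Z)).inv).2.unop =
      swapRight R.2.unop Z Z ≫ (β_ (R.2.unop ⊗ Z) Z).hom := by
    change (((α_ R.2.unop Z Z).hom ≫ R.2.unop ◁ ((((β_ Z Z).hom ≫ (ρ_ Z).inv ▷ Z) ≫
      (α_ Z (𝟙_ C) Z).hom) ≫ Z ◁ (λ_ Z).hom)) ≫ (α_ R.2.unop Z Z).inv) ≫
        (β_ (R.2.unop ⊗ Z) Z).hom = _
    simp [swapRight]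
  rw [h1, h2]
  exact Test.cup_cap_neg hT θ

/-- The extension of `C × Cᵒᵖ` by cups and caps: a compact closed category that contains `C`. -/
abbrev Envelope := Extension (cupCapClass hT)

/-- An object of `C` in the envelope. -/
abbrev posObj (Z : C) : Envelope hT := (Extension.incl (cupCapClass hT)).obj (pos Z)

/-- The formal dual of an object of `C` in the envelope. -/
abbrev negObj (Z : C) : Envelope hT := (Extension.incl (cupCapClass hT)).obj (neg Z)

instance posExactPairing (Z : C) : ExactPairing (posObj hT Z) (negObj hT Z) where
  coevaluation' := ⟨(testCup hT Z).hom ≫ (lift _).map (deltaSplit Z).hom,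
    .comp (.of (.cup Z)) (.base _)⟩
  evaluation' := ⟨(lift _).map (deltaMerge Z).hom ≫ (testCap hT Z).hom,
    .comp (.base _) (.of (.cap Z))⟩
  coevaluation_evaluation' := Subtype.ext <|
    loop_triangle_left _ _ _ _ (loop_left hT Z)
  evaluation_coevaluation' := Subtype.ext <|
    loop_triangle_right _ _ _ _ (loop_right hT Z)

/-- Every object of the envelope is the tensor product of an object of `C` and a formal dual. -/
def posNegIso (A : Envelope hT) : A ≅ posObj hT A.of.1 ⊗ negObj hT A.of.2.unop :=
  (Extension.incl (cupCapClass hT)).mapIso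
    (Iso.prod (ρ_ A.of.1).symm (λ_ A.of.2).symm : A.of ≅ pos A.of.1 ⊗ neg A.of.2.unop)

instance envelopeRightRigid : RightRigidCategory (Envelope hT) where
  rightDual A :=
    { rightDual := posObj hT A.of.2.unop ⊗ negObj hT A.of.1
      exact :=
        letI : ExactPairing (negObj hT A.of.2.unop) (posObj hT A.of.2.unop) :=
          BraidedCategory.exactPairing_swap _ _
        exactPairingCongrLeft (posNegIso hT A) }

/-- The functor `X ↦ (X, 𝟙)`. -/
def posFunctor (C : Type u) [Category.{v} C] [MonoidalCategory C] : C ⥤ C × Cᵒᵖ where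
  obj X := pos X
  map f := posHom f

variable (C) in
/-- The monoidal structure of `X ↦ (X, 𝟙)`, given by `𝟙 ⊗ 𝟙 ≅ 𝟙` in the second component. -/
def posFunctorCore : (posFunctor C).CoreMonoidal where
  εIso := Iso.refl _
  μIso X Y := Iso.prod (Iso.refl (X ⊗ Y)) (λ_ (𝟙_ Cᵒᵖ))
  μIso_hom_natural_left f X := by ext <;> simp [posFunctor]
  μIso_hom_natural_right f X := by ext <;> simp [posFunctor]
  associativity X Y Z := by
    ext
    · simp [posFunctor]
    · simp [posFunctor]
      monoidal
  left_unitality X := by ext <;> simp [posFunctor]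
  right_unitality X := by ext <;> simp [posFunctor, unitors_equal]

instance : (posFunctor C).Braided where
  toMonoidal := (posFunctorCore C).toMonoidal
  braided X Y := by
    change (Iso.prod (Iso.refl (X ⊗ Y)) (λ_ (𝟙_ Cᵒᵖ))).hom ≫ posHom (β_ X Y).hom =
      (β_ (pos X) (pos Y)).hom ≫ (Iso.prod (Iso.refl (Y ⊗ X)) (λ_ (𝟙_ Cᵒᵖ))).hom
    refine Prod.ext ?_ ?_
    · change 𝟙 _ ≫ (β_ X Y).hom = (β_ X Y).hom ≫ 𝟙 _
      simp
    · change (λ_ (𝟙_ Cᵒᵖ)).hom ≫ 𝟙 _ = (β_ (𝟙_ Cᵒᵖ) (𝟙_ Cᵒᵖ)).hom ≫ (λ_ (𝟙_ Cᵒᵖ)).hom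
      rw [braiding_leftUnitor, Category.comp_id, unitors_equal]

/-- A morphism `X ⊗ U ⟶ Y ⊗ U` of `C` between the tensor products in `C × Cᵒᵖ`. -/
abbrev posPosHom {X Y U : C} (f : X ⊗ U ⟶ Y ⊗ U) : pos X ⊗ pos U ⟶ pos Y ⊗ pos U :=
  Prod.mkHom f (𝟙 _)

/-- The trace in the envelope is the loop formed by the cup and the cap. -/
theorem dualTrace_val {X Y U : C} (f : X ⊗ U ⟶ Y ⊗ U) :
    (dualTrace (posObj hT U) (negObj hT U) (X := posObj hT X) (Y := posObj hT Y)
      ((Extension.incl (cupCapClass hT)).map (posPosHom f))).1 =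
        loop (testCup hT U) (testCap hT U) (posDeltaHom f) := by
  have h : posDeltaHom f = pos X ◁ (deltaSplit U).hom ≫ (α_ (pos X) (pos U) (neg U)).inv ≫
      posPosHom f ▷ neg U ≫ (α_ (pos Y) (pos U) (neg U)).hom ≫
        pos Y ◁ ((β_ (pos U) (neg U)).hom ≫ (deltaMerge U).hom) := by
    refine Prod.ext ?_ (Quiver.Hom.unop_inj ?_)
    · change f = X ◁ (ρ_ U).inv ≫ (α_ X U (𝟙_ C)).inv ≫ f ▷ 𝟙_ C ≫ (α_ Y U (𝟙_ C)).hom ≫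
        Y ◁ ((β_ U (𝟙_ C)).hom ≫ (λ_ U).hom)
      simp
    · change 𝟙 _ = ((((𝟙_ C ◁ ((ρ_ U).inv ≫ (β_ U (𝟙_ C)).hom)) ≫ (α_ (𝟙_ C) (𝟙_ C) U).inv) ≫
        𝟙 (𝟙_ C ⊗ 𝟙_ C) ▷ U) ≫ (α_ (𝟙_ C) (𝟙_ C) U).hom) ≫ 𝟙_ C ◁ (λ_ U).hom
      simp
  change (lift _).map (ρ_ (pos X)).inv ≫ wl (pos X) ((testCup hT U).hom ≫
      (lift _).map (deltaSplit U).hom) ≫ (lift _).map (α_ (pos X) (pos U) (neg U)).inv ≫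
      wr ((lift _).map (posPosHom f)) (neg U) ≫ (lift _).map (α_ (pos Y) (pos U) (neg U)).hom ≫
      wl (pos Y) ((lift _).map (β_ (pos U) (neg U)).hom ≫ (lift _).map (deltaMerge U).hom ≫
        (testCap hT U).hom) ≫ (lift _).map (ρ_ (pos Y)).hom = _
  rw [h, loop, wr_lift]
  simp only [wl_comp, wl_lift, Functor.map_comp, Category.assoc, MonoidalCategory.whiskerLeft_comp]

/-- The embedding of `C` in its envelope. -/
abbrev embedding : C ⥤ Envelope hT := posFunctor C ⋙ Extension.incl (cupCapClass hT)

theorem embedding_faithful : (embedding hT).Faithful where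
  map_injective h := lift_posHom_injective hT (congrArg Subtype.val h)

theorem embedding_injective : Function.Injective (embedding hT).obj := fun _ _ h =>
  congrArg (fun A : Envelope hT => A.of.1) h

theorem embedding_μ (X Y : C) : Functor.LaxMonoidal.μ (embedding hT) X Y =
    (Extension.incl (cupCapClass hT)).map
      ((Iso.prod (Iso.refl (X ⊗ Y)) (λ_ (𝟙_ Cᵒᵖ))).hom : pos X ⊗ pos Y ⟶ pos (X ⊗ Y)) :=
  Category.id_comp _

theorem embedding_δ (X Y : C) : Functor.OplaxMonoidal.δ (embedding hT) X Y =
    (Extension.incl (cupCapClass hT)).map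
      ((Iso.prod (Iso.refl (X ⊗ Y)) (λ_ (𝟙_ Cᵒᵖ))).inv : pos (X ⊗ Y) ⟶ pos X ⊗ pos Y) :=
  Category.comp_id _

theorem isInducedTrace_embedding :
    IsInducedTrace (embedding hT) (canonicalTrace (Envelope hT)) T := by
  intro X Y U f g
  have h : Functor.LaxMonoidal.μ (embedding hT) X U ≫ (embedding hT).map f ≫
      Functor.OplaxMonoidal.δ (embedding hT) Y U =
        (Extension.incl (cupCapClass hT)).map (posPosHom f) := by
    rw [embedding_μ, embedding_δ]
    refine ((Functor.map_comp _ _ _).trans (congrArg _ (Functor.map_comp _ _ _))).symm.trans ?_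
    refine congrArg (Extension.incl (cupCapClass hT)).map (Prod.ext ?_ ?_)
    · change 𝟙 _ ≫ f ≫ 𝟙 _ = f
      simp
    · change (λ_ (𝟙_ Cᵒᵖ)).hom ≫ 𝟙 _ ≫ (λ_ (𝟙_ Cᵒᵖ)).inv = 𝟙 _
      simp
  rw [h]
  have h1 := canonicalTrace_eq (negObj hT U) (X := posObj hT X) (Y := posObj hT Y)
    (U := posObj hT U) ((Extension.incl (cupCapClass hT)).map (posPosHom f))
  have h2 : (embedding hT).map g ∈ canonicalTrace (Envelope hT) ((embedding hT).obj U)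
      ((Extension.incl (cupCapClass hT)).map (posPosHom f)) ↔
      loop (testCup hT U) (testCap hT U) (posDeltaHom f) =
        (lift (testPresheaf hT)).map (posHom g) := by
    refine (iff_of_eq (congrArg (Membership.mem · _) h1)).trans (Part.mem_some_iff.trans ?_)
    rw [← dualTrace_val]
    exact ⟨fun h => (congrArg Subtype.val h).symm, fun h => Subtype.ext h.symm⟩
  exact Iff.trans ⟨loop_eq_of_mem hT, mem_of_loop_eq hT⟩ h2.symm

end Rigid

/-! ### Strictness -/

section Strict

open Opposite

variable {C : Type u} [Category.{v} C] [MonoidalCategory C]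

omit [MonoidalCategory C] in
theorem inv_eq_eqToHom {A B : C} {e : A ≅ B} {h : A = B} (he : e.hom = eqToHom h) :
    e.inv = eqToHom h.symm := by
  subst h
  rw [eqToHom_refl] at he ⊢
  rw [← cancel_epi e.hom, e.hom_inv_id, he, Category.id_comp]

theorem _root_.IsStrictMonoidal.op (h : IsStrictMonoidal C) : IsStrictMonoidal Cᵒᵖ where
  tensor_assoc X Y Z := congrArg Opposite.op (h.tensor_assoc X.unop Y.unop Z.unop)
  unit_tensor X := congrArg Opposite.op (h.unit_tensor X.unop)
  tensor_unit X := congrArg Opposite.op (h.tensor_unit X.unop)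
  associator_eq X Y Z := by
    rw [← op_inv_associator, inv_eq_eqToHom (h.associator_eq _ _ _), eqToHom_op]
  leftUnitor_eq X := by
    change (λ_ X.unop).inv.op = _
    rw [inv_eq_eqToHom (h.leftUnitor_eq _), eqToHom_op]
  rightUnitor_eq X := by
    change (ρ_ X.unop).inv.op = _
    rw [inv_eq_eqToHom (h.rightUnitor_eq _), eqToHom_op]

theorem _root_.IsStrictMonoidal.prod {D : Type u₁} [Category.{v₁} D] [MonoidalCategory D]
    (h : IsStrictMonoidal C) (h' : IsStrictMonoidal D) : IsStrictMonoidal (C × D) where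
  tensor_assoc X Y Z := Prod.ext (h.tensor_assoc X.1 Y.1 Z.1) (h'.tensor_assoc X.2 Y.2 Z.2)
  unit_tensor X := Prod.ext (h.unit_tensor X.1) (h'.unit_tensor X.2)
  tensor_unit X := Prod.ext (h.tensor_unit X.1) (h'.tensor_unit X.2)
  associator_eq X Y Z := Prod.ext
    ((h.associator_eq _ _ _).trans
      (eqToHom_fst (X := (X ⊗ Y) ⊗ Z) (Y := X ⊗ (Y ⊗ Z)) _).symm)
    ((h'.associator_eq _ _ _).trans
      (eqToHom_snd (X := (X ⊗ Y) ⊗ Z) (Y := X ⊗ (Y ⊗ Z)) _).symm)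
  leftUnitor_eq X := Prod.ext
    ((h.leftUnitor_eq _).trans (eqToHom_fst (X := 𝟙_ (C × D) ⊗ X) (Y := X) _).symm)
    ((h'.leftUnitor_eq _).trans (eqToHom_snd (X := 𝟙_ (C × D) ⊗ X) (Y := X) _).symm)
  rightUnitor_eq X := Prod.ext
    ((h.rightUnitor_eq _).trans (eqToHom_fst (X := X ⊗ 𝟙_ (C × D)) (Y := X) _).symm)
    ((h'.rightUnitor_eq _).trans (eqToHom_snd (X := X ⊗ 𝟙_ (C × D)) (Y := X) _).symm)

theorem _root_.IsStrictMonoidal.extension [SymmetricCategory C] {ι : Type w'}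
    {O : PresheafFamily.{u, v, w, w'} C ι} (S : CommutingClass O) (h : IsStrictMonoidal C) :
    IsStrictMonoidal (Extension S) where
  tensor_assoc X Y Z := congrArg Extension.mk (h.tensor_assoc X.of Y.of Z.of)
  unit_tensor X := congrArg Extension.mk (h.unit_tensor X.of)
  tensor_unit X := congrArg Extension.mk (h.tensor_unit X.of)
  associator_eq X Y Z :=
    (congrArg (Extension.incl S).map (h.associator_eq X.of Y.of Z.of)).trans
      (eqToHom_map (Extension.incl S) _)
  leftUnitor_eq X :=
    (congrArg (Extension.incl S).map (h.leftUnitor_eq X.of)).trans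
      (eqToHom_map (Extension.incl S) _)
  rightUnitor_eq X :=
    (congrArg (Extension.incl S).map (h.rightUnitor_eq X.of)).trans
      (eqToHom_map (Extension.incl S) _)

theorem isStrictMonoidalFunctor_embedding [SymmetricCategory C] {T : PartialTraceOp C}
    (hT : IsPartialTrace T) (h : IsStrictMonoidal C) :
    IsStrictMonoidalFunctor (embedding hT) where
  obj_tensor X Y := congrArg Extension.mk (Prod.ext rfl (h.op.unit_tensor _))
  obj_unit := rfl
  μ_eq X Y := by
    have hobj : pos X ⊗ pos Y = pos (X ⊗ Y) := Prod.ext rfl (h.op.unit_tensor _)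
    have key : ((Iso.prod (Iso.refl (X ⊗ Y)) (λ_ (𝟙_ Cᵒᵖ))).hom : pos X ⊗ pos Y ⟶ pos (X ⊗ Y)) =
        eqToHom hobj := by
      refine Prod.ext ?_ ?_
      · rw [eqToHom_fst]; rfl
      · rw [eqToHom_snd]; exact h.op.leftUnitor_eq _
    rw [embedding_μ, key]
    exact eqToHom_map (Extension.incl (cupCapClass hT)) _
  ε_eq := (Category.id_comp _).trans ((Extension.incl (cupCapClass hT)).map_id _)

end Strict

end PartialTrace

theorem mainTheorem1 :
    -- every partially traced category embeds faithfully in a compact closed category,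
    -- in such a way that its partial trace is the one induced by the canonical trace
    (∀ (C : Type u) [Category.{v} C] [MonoidalCategory C] [SymmetricCategory C]
      (T : PartialTraceOp C), IsPartialTrace T →
      ∃ (D : Type u) (_ : Category.{max u v} D) (_ : MonoidalCategory D)
        (_ : SymmetricCategory D) (_ : RightRigidCategory D) (F : C ⥤ D) (_ : F.Braided),
        F.Faithful ∧ Function.Injective F.obj ∧
        IsTotalTrace (canonicalTrace D) ∧
        IsInducedTrace F (canonicalTrace D) T ∧
        (IsStrictMonoidal C → IsStrictMonoidal D ∧ IsStrictMonoidalFunctor F)) ∧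
    -- conversely, a faithful strong symmetric monoidal functor into a partially (in particular,
    -- into a totally) traced category induces a partial trace on its domain
    (∀ (C : Type u₁) [Category.{v₁} C] [MonoidalCategory C] [SymmetricCategory C]
      (D : Type u₂) [Category.{v₂} D] [MonoidalCategory D] [SymmetricCategory D]
      (t : PartialTraceOp D) (F : C ⥤ D) [F.Braided] [F.Faithful], IsPartialTrace t →
      ∃! T : PartialTraceOp C, IsInducedTrace F t T ∧ IsPartialTrace T) := by
  refine ⟨fun C _ _ _ T hT => ?_, fun C _ _ _ D _ _ _ t F _ _ ht => ?_⟩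
  · exact ⟨PartialTrace.Envelope hT, inferInstance, inferInstance, inferInstance, inferInstance,
      PartialTrace.embedding hT, inferInstance, PartialTrace.embedding_faithful hT,
      PartialTrace.embedding_injective hT, PartialTrace.isTotalTrace_canonicalTrace,
      PartialTrace.isInducedTrace_embedding hT, fun h =>
        ⟨(h.prod h.op).extension _, PartialTrace.isStrictMonoidalFunctor_embedding hT h⟩⟩
  · have h : IsInducedTrace F t (PartialTrace.inducedTrace t F) :=
      PartialTrace.isInducedTrace_inducedTrace t F
    exact ⟨PartialTrace.inducedTrace t F, ⟨h, PartialTrace.IsInducedTrace.isPartialTrace h ht⟩,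
      fun T' h' => PartialTrace.IsInducedTrace.unique h'.1 h⟩
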